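/- **Simple neural programs.** A simple neural program (SNP) $P$ has $V$ variables, each declared as an input, as an integer variable with a fixed initial value in $\mathbb N_0$, or as a boolean variable with initial value $0$ or $1$; let $I$ be the number of inputs. It is a finite sequence of statements followed by one final statement `return v`. The statements are: $k\leftarrow a$; $k\leftarrow a$ if $c$ else $b$ (with $c$ a boolean variable, tested for $c=1$); $k\leftarrow i+c$ ($c\in\mathbb Z$ constant); $k\leftarrow c\cdot i$ ($c\in\mathbb N_0$ constant); $k\leftarrow \mathbf 1\{i\mathrel{r}c\}$ ($c\in\mathbb N_0$ constant); $k\leftarrow i+j$; $k\leftarrow i-j$; $k\leftarrow\mathbf 1\{i\mathrel{r}j\}$; and loops `for i = s,...,e:` followed by a clause, i.e. a finite sequence of such statements (loops may be nested). Here $i,j,k$ are variables, $a,b,s,e$ are variables or constants in $\mathbb N_0$, and $r\in\{=,<,\le,>,\ge\}$. The clause of a loop may modify neither the loop counter nor the final variable $e$. The clause is executed once for each value $s,s+1,\dots,e$ of the counter, the range being computed on entering the loop; nothing happens if it is empty. The length $L$ of $P$ is the number of its statements, including those in clauses and the `return` statement, but not the declarations. The returned value on input $x$ is $P(x)$. With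 $[N]=\{1,\dots,N\}$, $P$ is $B$-bounded on $[N]^I$ if all constants in its statements are at most $B$ in absolute value and, for each input $x\in[N]^I$ and at all times of the run, all variables have values in $\{0,1,\dots,B\}$ and boolean variables have values in $\{0,1\}$. **Networks and description length.** A network $F$ with $I$ free inputs consists of an input vector, of which $I$ coordinates are free and the others are fixed integers, and of $D\ge1$ layers $g_i(z)=W_iz+b_i$ with integer entries and compatible dimensions, the last one with output dimension $1$. It computes the function $F(x)=g_D\circ\sigma\circ g_{D-1}\circ\cdots\circ\sigma\circ g_1$ of the input vector whose free coordinates are filled, in order, with $x\in\mathbb R^I$, where $\sigma(t)=\max(t,0)$ coordinatewise. Its full encoding is the sequence over the alphabet $\{\mathcal I,\ \text{“,”},\ -,\ 0,\ 1,\ (,\ ),\ *,\ \mathcal W,\ \mathcal B\}$ which lists, separated by commas, the input coordinates ($\mathcal I$ for a free one, otherwise the fixed value), and then for each layer $\mathcal W$, the entries of $W_i$ row by row, $\mathcal B$, and the entries of $b_i$; all integers are in binary, with $-$ in front of negative ones. A sequence of symbols describes $F$ if it becomes the full encoding of $F$ when all (possibly nested) repetitions $(u)*k$ are replaced by $k$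 copies of $u$; here $k\ge1$ is in binary and is formed by all the digits that follow the star. The description length of $F$ is the least length of a sequence that describes $F$. Given data $(x_i,y_i)_{i=1}^n$, a minimum description length (MDL) interpolating network is a network with $F(x_i)=y_i$ for all $i$ whose description length is the least among all networks with this property. **Corollary 5.2.** There is an absolute constant $C>0$ with the following property. Let $N\in\mathbb N_0$, let $P$ be an SNP of length $L$ with $V$ variables and $I$ inputs that is $B(N)$-bounded on $[N]^I$ for an integer $B(N)\ge2$, let $\mu$ be a probability distribution on $[N]^I$, and let $n\ge1$. Let $X_1,\dots,X_n$ be i.i.d. with law $\mu$, let $Y_i=P(X_i)$, and let $x\sim\mu$ be independent of $X_1,\dots,X_n$. Let $\widehat f_{\mathrm{MDL}}$ be any function of the data set $(X_i,Y_i)_{i=1}^n$ whose value is always an MDL interpolating network of that data set. Then $$\mathbb P\bigl(\widehat f_{\mathrm{MDL}}(x)\ne P(x)\bigr)\le\frac{C\,L^3V^2\ln B(N)}{n},$$ where the probability is over both the data set and the test point $x$. -/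

import Mathlib

open MeasureTheory

namespace SNPNet

/-! ## Input vectors with fixed and free coordinates -/

/-- Number of free coordinates of an input pattern: `none` marks a free coordinate, `some c` a
coordinate that is fixed to the integer `c`. -/
def freeCount {m : ℕ} (s : Fin m → Option ℤ) : ℕ :=
  (Finset.univ.filter fun p => s p = none).card

/-- Position of the coordinate `p` among the free coordinates (counting from `0`). -/
def freeRank {m : ℕ} (s : Fin m → Option ℤ) (p : Fin m) : ℕ :=
  (Finset.univ.filter fun q => q < p ∧ s q = none).card

/-- The vector obtained from the pattern `s` by writing `x 0, x 1, …` into the free coordinates, in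
order. If `freeCount s = I`, every free coordinate has rank `< I`, so that the last value `0` is
never used. -/
def fill {R : Type*} [Ring R] {m I : ℕ} (s : Fin m → Option ℤ) (x : Fin I → R) : Fin m → R :=
  fun p => match s p with
    | some c => (c : R)
    | none => if h : freeRank s p < I then x ⟨freeRank s p, h⟩ else 0

/-! ## Simple neural programs: syntax -/

/-- Declaration of a variable: `input x`, `int x = c`, or `bool x = b`. -/
inductive Decl where
  | input : Decl
  | int (c : ℕ) : Decl
  | bool (b : Bool) : Decl

/-- Initial content of a declared variable (`none` for an input). -/
def Decl.slot : Decl → Option ℤ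
  | .input => none
  | .int c => some c
  | .bool b => some (if b then 1 else 0)

/-- The variable is declared boolean. -/
def Decl.IsBool : Decl → Prop
  | .bool _ => True
  | _ => False

/-- A quantity in a statement: a nonnegative constant or a variable. -/
inductive Operand (V : ℕ) where
  | const (c : ℕ) : Operand V
  | var (v : Fin V) : Operand V

/-- The comparisons `==`, `<`, `<=`, `>`, `>=`. -/
inductive Cmp where
  | eq | lt | le | gt | ge

/-- The statements other than `for` and `return`. The first argument `k` is always the variable
that receives the result. -/
inductive Cmd (V : ℕ) where
  /-- `k = a` -/
  | assign (k : Fin V) (a : Operand V) : Cmd V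
  /-- `k = a if c else b` -/
  | ite (k c : Fin V) (a b : Operand V) : Cmd V
  /-- `k = i + c` with an integer constant `c` -/
  | addConst (k i : Fin V) (c : ℤ) : Cmd V
  /-- `k = c * i` with a nonnegative constant `c` -/
  | mulConst (k : Fin V) (c : ℕ) (i : Fin V) : Cmd V
  /-- `k = (i r c)` with a nonnegative constant `c` -/
  | cmpConst (k : Fin V) (r : Cmp) (i : Fin V) (c : ℕ) : Cmd V
  /-- `k = i + j` -/
  | add (k i j : Fin V) : Cmd V
  /-- `k = i - j` -/
  | sub (k i j : Fin V) : Cmd V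
  /-- `k = (i r j)` -/
  | cmp (k : Fin V) (r : Cmp) (i j : Fin V) : Cmd V

/-- A sequence of statements, with the clauses of the `for` loops as nested sequences:
`loop i s e clause rest` is the statement `for i = s,...,e: clause` followed by `rest`. -/
inductive Block (V : ℕ) where
  | done : Block V
  | cmd (c : Cmd V) (rest : Block V) : Block V
  | loop (i : Fin V) (s e : Operand V) (clause rest : Block V) : Block V

/-- The variable a statement writes to. -/
def Cmd.target {V : ℕ} : Cmd V → Fin V
  | .assign k _ => k
  | .ite k _ _ _ => k
  | .addConst k _ _ => k
  | .mulConst k _ _ => k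
  | .cmpConst k _ _ _ => k
  | .add k _ _ => k
  | .sub k _ _ => k
  | .cmp k _ _ _ => k

/-- Some statement of the block (at any nesting depth) writes to the variable `v`; a `for` loop
writes to its counter. -/
def Block.Modifies {V : ℕ} (v : Fin V) : Block V → Prop
  | .done => False
  | .cmd c rest => c.target = v ∨ rest.Modifies v
  | .loop i _ _ clause rest => i = v ∨ clause.Modifies v ∨ rest.Modifies v

/-- The conditions of `if` statements are boolean variables. -/
def Cmd.WellFormed {V : ℕ} (isBool : Fin V → Prop) : Cmd V → Prop
  | .ite _ c _ _ => isBool c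
  | _ => True

/-- The conditions of `if` statements are boolean variables, and the clause of a `for` loop modifies
neither the counter nor the final variable of the loop. -/
def Block.WellFormed {V : ℕ} (isBool : Fin V → Prop) : Block V → Prop
  | .done => True
  | .cmd c rest => c.WellFormed isBool ∧ rest.WellFormed isBool
  | .loop i _ e clause rest =>
      ¬ clause.Modifies i ∧ (∀ v, e = Operand.var v → ¬ clause.Modifies v) ∧
        clause.WellFormed isBool ∧ rest.WellFormed isBool

/-- Number of statements, those in the clauses of `for` loops included. -/
def Block.length {V : ℕ} : Block V → ℕ
  | .done => 0
  | .cmd _ rest => 1 + rest.length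
  | .loop _ _ _ clause rest => 1 + clause.length + rest.length

def Operand.ConstLe {V : ℕ} (B : ℕ) : Operand V → Prop
  | .const c => c ≤ B
  | .var _ => True

def Cmd.ConstLe {V : ℕ} (B : ℕ) : Cmd V → Prop
  | .assign _ a => a.ConstLe B
  | .ite _ _ a b => a.ConstLe B ∧ b.ConstLe B
  | .addConst _ _ c => c.natAbs ≤ B
  | .mulConst _ c _ => c ≤ B
  | .cmpConst _ _ _ c => c ≤ B
  | .add _ _ _ => True
  | .sub _ _ _ => True
  | .cmp _ _ _ _ => True

/-- All constants written in the statements are at most `B` in absolute value. -/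
def Block.ConstLe {V : ℕ} (B : ℕ) : Block V → Prop
  | .done => True
  | .cmd c rest => c.ConstLe B ∧ rest.ConstLe B
  | .loop _ s e clause rest =>
      s.ConstLe B ∧ e.ConstLe B ∧ clause.ConstLe B ∧ rest.ConstLe B

/-- An (atomic) simple neural program with `V` variables, `I` of which are inputs: the variable
context, the statements, and the final `return` statement. -/
structure SNP (V I : ℕ) where
  decl : Fin V → Decl
  inputs_eq : freeCount (fun v => (decl v).slot) = I
  body : Block V
  wellFormed : body.WellFormed fun v => (decl v).IsBool
  ret : Fin V

/-- Number of statements; declarations do not count, the `return` statement does. -/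
def SNP.length {V I : ℕ} (P : SNP V I) : ℕ := P.body.length + 1

/-! ## Simple neural programs: semantics

States are integer valued, so that every operation is defined; that all the values occurring in a
run are nonnegative is part of `SNP.BoundedOn`. -/

def Operand.eval {V : ℕ} (σ : Fin V → ℤ) : Operand V → ℤ
  | .const c => c
  | .var v => σ v

def Cmp.test : Cmp → ℤ → ℤ → Bool
  | .eq, a, b => decide (a = b)
  | .lt, a, b => decide (a < b)
  | .le, a, b => decide (a ≤ b)
  | .gt, a, b => decide (a > b)
  | .ge, a, b => decide (a ≥ b)

/-- The value a statement computes. -/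
def Cmd.value {V : ℕ} (σ : Fin V → ℤ) : Cmd V → ℤ
  | .assign _ a => a.eval σ
  | .ite _ c a b => if σ c = 1 then a.eval σ else b.eval σ
  | .addConst _ i c => σ i + c
  | .mulConst _ c i => c * σ i
  | .cmpConst _ r i c => if r.test (σ i) c then 1 else 0
  | .add _ i j => σ i + σ j
  | .sub _ i j => σ i - σ j
  | .cmp _ r i j => if r.test (σ i) (σ j) then 1 else 0

def Cmd.exec {V : ℕ} (c : Cmd V) (σ : Fin V → ℤ) : Fin V → ℤ :=
  Function.update σ c.target (c.value σ)

/-- State after the first `m` repetitions of a `for` loop with counter `i` and start `a`, where `f`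
is the effect of the clause: in repetition number `m` (from `0`) the counter is `a + m`. -/
def loopState {V : ℕ} (f : (Fin V → ℤ) → Fin V → ℤ) (i : Fin V) (a : ℤ) (σ : Fin V → ℤ) :
    ℕ → Fin V → ℤ
  | 0 => σ
  | m + 1 => f (Function.update (loopState f i a σ m) i (a + m))

/-- Number of repetitions of `for i = a,...,b`. -/
def repetitions (a b : ℤ) : ℕ := (b + 1 - a).toNat

/-- The effect of a sequence of statements. The range of a `for` loop is computed when the loop is
entered; if it is empty, nothing happens. -/
def Block.exec {V : ℕ} : Block V → (Fin V → ℤ) → Fin V → ℤ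
  | .done, σ => σ
  | .cmd c rest, σ => rest.exec (c.exec σ)
  | .loop i s e clause rest, σ =>
      rest.exec
        (loopState clause.exec i (s.eval σ) σ (repetitions (s.eval σ) (e.eval σ)))

/-- Every state that the execution of the block from `σ` produces (after each statement and after
each update of a loop counter) satisfies `ok`. -/
def Block.AllStates {V : ℕ} (ok : (Fin V → ℤ) → Prop) : Block V → (Fin V → ℤ) → Prop
  | .done, _ => True
  | .cmd c rest, σ => ok (c.exec σ) ∧ rest.AllStates ok (c.exec σ)
  | .loop i s e clause rest, σ =>
      (∀ m < repetitions (s.eval σ) (e.eval σ),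
        ok (Function.update (loopState clause.exec i (s.eval σ) σ m) i (s.eval σ + m)) ∧
        clause.AllStates ok
          (Function.update (loopState clause.exec i (s.eval σ) σ m) i (s.eval σ + m))) ∧
      rest.AllStates ok
        (loopState clause.exec i (s.eval σ) σ (repetitions (s.eval σ) (e.eval σ)))

/-- State at the beginning of the run on the input `x`. -/
def SNP.init {V I : ℕ} (P : SNP V I) (x : Fin I → ℤ) : Fin V → ℤ :=
  fill (fun v => (P.decl v).slot) x

/-- The result `P(x)`. -/
def SNP.eval {V I : ℕ} (P : SNP V I) (x : Fin I → ℤ) : ℤ :=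
  P.body.exec (P.init x) P.ret

/-- The values of all variables are nonnegative integers `≤ B`, and those of boolean variables are
`0` or `1`. -/
def SNP.OkState {V I : ℕ} (P : SNP V I) (B : ℕ) (σ : Fin V → ℤ) : Prop :=
  ∀ v, 0 ≤ σ v ∧ σ v ≤ B ∧ ((P.decl v).IsBool → σ v ≤ 1)

/-- The input set `[N]^I`, where `[N] = {1, …, N}`. -/
abbrev Box (I N : ℕ) : Type := Fin I → Set.Icc (1 : ℕ) N

/-- A point of `[N]^I` as a vector over a ring. -/
def Box.vec (R : Type*) [Ring R] {I N : ℕ} (x : Box I N) : Fin I → R :=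
  fun j => ((x j : ℕ) : R)

/-- `P` runs on all inputs in `[N]^I` and is `B`-bounded there: the constants of `P` and the values
of the variables throughout the run do not exceed `B`. -/
def SNP.BoundedOn {V I : ℕ} (P : SNP V I) (N B : ℕ) : Prop :=
  P.body.ConstLe B ∧
  ∀ x : Box I N,
    P.OkState B (P.init (x.vec ℤ)) ∧ P.body.AllStates (P.OkState B) (P.init (x.vec ℤ))

/-! ## ReLU networks -/

/-- Layers `g₁, …, g_D`, `D ≥ 1`, of a feedforward network from dimension `n` to dimension `m`,
each given by a weight matrix and a bias vector with integer entries. -/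
inductive Layers : ℕ → ℕ → Type where
  | last {n m : ℕ} (W : Matrix (Fin m) (Fin n) ℤ) (b : Fin m → ℤ) : Layers n m
  | cons {n k m : ℕ} (W : Matrix (Fin k) (Fin n) ℤ) (b : Fin k → ℤ) (rest : Layers k m) :
      Layers n m

/-- The affine map `x ↦ W x + b`. -/
noncomputable def affine {n m : ℕ} (W : Matrix (Fin m) (Fin n) ℤ) (b : Fin m → ℤ)
    (x : Fin n → ℝ) : Fin m → ℝ :=
  fun i => (∑ j, (W i j : ℝ) * x j) + (b i : ℝ)

/-- The map `g_D ∘ σ ∘ g_{D-1} ∘ ⋯ ∘ σ ∘ g₁` with `σ(x) = max(x, 0)`. -/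
noncomputable def Layers.eval : {n m : ℕ} → Layers n m → (Fin n → ℝ) → Fin m → ℝ
  | _, _, .last W b, x => affine W b x
  | _, _, .cons W b rest, x => rest.eval fun i => max (affine W b x i) 0

/-- A feedforward ReLU network with one output, applied to an input vector of which `I` coordinates
are free variables and the others are fixed integers. -/
structure Network (I : ℕ) where
  dim : ℕ
  input : Fin dim → Option ℤ
  free_eq : freeCount input = I
  layers : Layers dim 1

/-- The function of `I` variables computed by a network. -/
noncomputable def Network.eval {I : ℕ} (F : Network I) (x : Fin I → ℝ) : ℝ :=
  F.layers.eval (fill F.input x) 0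

/-! ## Description length -/

/-- The alphabet: the symbol for a free input, the comma, `-`, `0`, `1`, `(`, `)`, `*`, and the
symbols announcing a weight matrix and a bias vector. -/
inductive Symbol where
  | inp | comma | minus | zero | one | lpar | rpar | star | wgt | bias

def Symbol.IsDigit : Symbol → Prop
  | .zero => True
  | .one => True
  | _ => False

/-- Symbols that are not part of the repetition notation. -/
def Symbol.IsPlain : Symbol → Prop
  | .lpar => False
  | .rpar => False
  | .star => False
  | _ => True

/-- Binary expansion, most significant digit first, with `0` written as the digit `0`. -/
def natBin (n : ℕ) : List Symbol :=
  if n = 0 then [.zero]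
  else (Nat.digits 2 n).reverse.map fun d => if d = 0 then Symbol.zero else Symbol.one

/-- Binary expansion of an integer. -/
def intBin (z : ℤ) : List Symbol :=
  if z < 0 then .minus :: natBin z.natAbs else natBin z.natAbs

/-- For each layer: the weight symbol, the entries of the matrix row by row, the bias symbol, the
entries of the bias vector. -/
def Layers.tokens : {n m : ℕ} → Layers n m → List (List Symbol)
  | _, _, .last W b =>
      [.wgt] :: ((List.ofFn fun i => List.ofFn fun j => intBin (W i j)).flatten ++
        [.bias] :: List.ofFn fun i => intBin (b i))
  | _, _, .cons W b rest =>
      [.wgt] :: ((List.ofFn fun i => List.ofFn fun j => intBin (W i j)).flatten ++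
        [.bias] :: ((List.ofFn fun i => intBin (b i)) ++ rest.tokens))

/-- An input coordinate: the free symbol, or the value the coordinate is fixed to. -/
def slotToken : Option ℤ → List Symbol
  | none => [.inp]
  | some c => intBin c

/-- The full symbol encoding of a network: the input vector followed by the layers, all separated
by commas. -/
def Network.encode {I : ℕ} (F : Network I) : List Symbol :=
  List.intercalate [.comma] ((List.ofFn fun p => slotToken (F.input p)) ++ F.layers.tokens)

/-- `Expands s t`: the sequence `s` becomes `t`, which is free of the symbols `(`, `)`, `*`, when all
repetitions `(u)*k` of substrings in `s` are carried out. Repetitions may be nested. The number `k`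
consists of all the binary digits that directly follow the star. -/
inductive Expands : List Symbol → List Symbol → Prop where
  | nil : Expands [] []
  | plain (a : Symbol) (s t : List Symbol) :
      a.IsPlain → Expands s t → Expands (a :: s) (a :: t)
  | rep (k : ℕ) (u u' s t : List Symbol) :
      1 ≤ k → Expands u u' → Expands s t → (∀ a ∈ s.head?, ¬ a.IsDigit) →
      Expands (.lpar :: (u ++ .rpar :: .star :: (natBin k ++ s)))
        ((List.replicate k u').flatten ++ t)

/-- The symbol sequence `s` describes the network `F`. -/
def Describes {I : ℕ} (s : List Symbol) (F : Network I) : Prop := Expands s F.encode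

/-- The minimum length of a symbol sequence that describes `F` (there always is one, since the full
encoding of `F` describes `F`). -/
noncomputable def Network.descLength {I : ℕ} (F : Network I) : ℕ :=
  sInf {l | ∃ s : List Symbol, Describes s F ∧ s.length = l}

/-! ## Data and minimum description length interpolation -/

/-- `F` interpolates the data `(x_i, y_i)`. -/
def Interpolates {I N n : ℕ} (D : Fin n → Box I N × ℤ) (F : Network I) : Prop :=
  ∀ i, F.eval ((D i).1.vec ℝ) = ((D i).2 : ℝ)

/-- `F` has minimum description length among all networks that interpolate the data. -/
def IsMDLInterpolator {I N n : ℕ} (D : Fin n → Box I N × ℤ) (F : Network I) : Prop :=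
  Interpolates D F ∧ ∀ G : Network I, Interpolates D G → F.descLength ≤ G.descLength

/-- The data set `(X_i, P(X_i))`. -/
def SNP.dataset {V I N n : ℕ} (P : SNP V I) (X : Fin n → Box I N) : Fin n → Box I N × ℤ :=
  fun i => (X i, P.eval ((X i).vec ℤ))

end SNPNet

open SNPNet

namespace SNPNet

/-! ## Binary expansions -/

/-! The proof is an Occam argument. Suppose that some interpolating network has a description of at
most `S` symbols. Then the MDL interpolator has one too. A description determines the network, so at
most `11 ^ S` functions compete. A learner that is consistent with `n` samples and picks from a
class of `K` functions has expected error at most `(ln K + 1) / n`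
(`measureReal_mem_le_of_consistent`). It remains to find a network that computes `P` on the whole
box and has `S = O(L³V² ln B)`.

Counting rests on two unique-decoding statements: a symbol sequence has at most one expansion
(`Expands.unique`), and the full encoding determines the network (`Network.encode_injective`).

For the network, the program is compiled into rectified assignments `k ← max(affine, 0)`, one per
layer, on a state of width `w = V + 2 + 3L`. Every loop is unrolled exactly `B + 1` times, whatever
its actual range. All copies are then identical, and the repetition notation charges for one copy
plus `O(log B)` symbols. A 0/1 flag for each nesting depth switches off the surplus copies, and all
conditional choices use a large constant `M = B²`. Correctness is `Block.runAll_code`. The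
description contains `O(L)` layers, each costing `O(w² log B)` symbols (`Block.hasDescription`).
Since `w = O(LV)`, this gives the required order. -/

lemma natBin_eq_map {n : ℕ} (hn : n ≠ 0) :
    natBin n = (Nat.digits 2 n).reverse.map fun d => if d = 0 then Symbol.zero else Symbol.one := by
  simp [natBin, hn]

lemma isDigit_of_mem_natBin {n : ℕ} {a : Symbol} (ha : a ∈ natBin n) : a.IsDigit := by
  unfold natBin at ha
  split_ifs at ha
  · simp only [List.mem_singleton] at ha
    subst ha; trivial
  · obtain ⟨d, -, rfl⟩ := List.mem_map.1 ha
    split_ifs <;> trivial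

lemma length_natBin (n : ℕ) : (natBin n).length = Nat.log 2 n + 1 := by
  unfold natBin
  split_ifs with h
  · simp [h]
  · simp [Nat.length_digits 2 n (by norm_num) h]

/-- Value of a digit symbol. -/
def Symbol.digitVal : Symbol → ℕ
  | .one => 1
  | _ => 0

lemma natBin_injective : Function.Injective natBin := by
  have key : ∀ n, Nat.ofDigits 2 ((natBin n).reverse.map Symbol.digitVal) = n := by
    intro n
    by_cases h : n = 0
    · subst h; simp [natBin, Symbol.digitVal]
    · rw [natBin_eq_map h, ← List.map_reverse, List.reverse_reverse, List.map_map]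
      have : (Nat.digits 2 n).map (Symbol.digitVal ∘
          fun d => if d = 0 then Symbol.zero else Symbol.one) = (Nat.digits 2 n).map id := by
        apply List.map_congr_left
        intro d hd
        have := Nat.digits_lt_base (by norm_num : 1 < 2) hd
        have : d = 0 ∨ d = 1 := by omega
        rcases this with rfl | rfl <;> simp [Symbol.digitVal]
      rw [this, List.map_id, Nat.ofDigits_digits]
  intro m n h
  rw [← key m, h, key n]

lemma notMem_natBin {n : ℕ} {a : Symbol} (ha : ¬ a.IsDigit) : a ∉ natBin n :=
  fun h => ha (isDigit_of_mem_natBin h)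

lemma intBin_injective : Function.Injective intBin := by
  intro a b h
  unfold intBin at h
  have aux : ∀ m n : ℕ, Symbol.minus :: natBin m ≠ natBin n := fun m n h =>
    notMem_natBin (n := n) (a := .minus) (by simp [Symbol.IsDigit]) (by rw [← h]; simp)
  split_ifs at h with h1 h2 h2
  · have := natBin_injective (List.cons_injective h); omega
  · exact absurd h (aux _ _)
  · exact absurd h.symm (aux _ _)
  · have := natBin_injective h; omega

lemma mem_intBin {z : ℤ} {a : Symbol} (ha : a ∈ intBin z) : a = .minus ∨ a.IsDigit := by
  unfold intBin at ha
  split_ifs at ha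
  · rcases List.mem_cons.1 ha with rfl | h
    · exact .inl rfl
    · exact .inr (isDigit_of_mem_natBin h)
  · exact .inr (isDigit_of_mem_natBin ha)

lemma length_intBin_le (z : ℤ) : (intBin z).length ≤ Nat.log 2 z.natAbs + 2 := by
  unfold intBin
  split_ifs <;> simp [length_natBin]

lemma intBin_ne_singleton {z : ℤ} {a : Symbol} (h1 : a ≠ .minus) (h2 : ¬ a.IsDigit) :
    intBin z ≠ [a] := fun h => (mem_intBin (z := z) (a := a) (by simp [h])).elim h1 h2

lemma slotToken_injective : Function.Injective slotToken := by
  intro a b h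
  cases a <;> cases b <;> simp only [slotToken] at h
  · rfl
  · exact absurd h.symm (intBin_ne_singleton (by simp) (by simp [Symbol.IsDigit]))
  · exact absurd h (intBin_ne_singleton (by simp) (by simp [Symbol.IsDigit]))
  · rw [intBin_injective h]

lemma slotToken_ne_wgt (o : Option ℤ) : slotToken o ≠ [.wgt] := by
  cases o
  · simp [slotToken]
  · exact intBin_ne_singleton (by simp) (by simp [Symbol.IsDigit])

/-! ## Expansion of repetitions -/

/-- Contribution of a symbol to the nesting depth of parentheses. -/
def Symbol.paren : Symbol → ℤ
  | .lpar => 1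
  | .rpar => -1
  | _ => 0

/-- The parentheses in the sequence are balanced. -/
def Balanced (s : List Symbol) : Prop :=
  (s.map Symbol.paren).sum = 0 ∧ ∀ n, 0 ≤ ((s.take n).map Symbol.paren).sum

lemma Symbol.paren_of_isPlain {a : Symbol} (h : a.IsPlain) : a.paren = 0 := by
  cases a <;> simp_all [Symbol.IsPlain, Symbol.paren]

lemma Balanced.of_paren_eq_zero {s : List Symbol} (h : ∀ a ∈ s, a.paren = 0) : Balanced s := by
  have key : ∀ t : List Symbol, (∀ a ∈ t, a.paren = 0) → (t.map Symbol.paren).sum = 0 := by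
    intro t ht
    apply List.sum_eq_zero
    simpa using ht
  exact ⟨key s h, fun n => (key _ fun a ha => h a (List.mem_of_mem_take ha)).ge⟩

lemma Balanced.append {s t : List Symbol} (hs : Balanced s) (ht : Balanced t) :
    Balanced (s ++ t) := by
  refine ⟨by simp [hs.1, ht.1], fun n => ?_⟩
  rw [List.take_append, List.map_append, List.sum_append]
  exact add_nonneg (hs.2 _) (ht.2 _)

lemma Balanced.wrap {s t : List Symbol} (hs : Balanced s) (ht : Balanced t) :
    Balanced (.lpar :: (s ++ .rpar :: t)) := by
  refine ⟨by simp [hs.1, ht.1, Symbol.paren], fun n => ?_⟩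
  cases n with
  | zero => simp
  | succ n =>
    rw [List.take_succ_cons, List.take_append]
    have h1 := hs.2 n
    rcases Nat.lt_or_ge s.length n with h | h
    · obtain ⟨m, hm⟩ : ∃ m, n - s.length = m + 1 := ⟨n - s.length - 1, by omega⟩
      have h2 := ht.2 m
      rw [List.take_of_length_le h.le, hm, List.take_succ_cons]
      simp only [List.map_cons, List.map_append, List.sum_cons, List.sum_append, hs.1, Symbol.paren]
      omega
    · rw [Nat.sub_eq_zero_of_le h]
      simp only [List.map_cons, List.take_zero, List.append_nil, List.sum_cons, Symbol.paren]
      omega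

lemma Expands.balanced {s t : List Symbol} (h : Expands s t) : Balanced s := by
  induction h with
  | nil => exact .of_paren_eq_zero (by simp)
  | plain a s t ha _ ih =>
    exact Balanced.append (s := [a]) (.of_paren_eq_zero (by simp [Symbol.paren_of_isPlain ha])) ih
  | rep k u u' s t _ _ _ _ ihu ihs =>
    refine ihu.wrap (Balanced.append (s := .star :: natBin k) (.of_paren_eq_zero ?_) ihs)
    intro a ha
    rcases List.mem_cons.1 ha with rfl | ha
    · rfl
    · have := isDigit_of_mem_natBin ha
      cases a <;> simp_all [Symbol.IsDigit, Symbol.paren]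

/-- If `u` were shorter than `v`, then `u` followed by a closing parenthesis would be a prefix of
`v` of depth `-1`. Hence the parenthesis that closes a repetition is determined. -/
lemma Balanced.append_rpar_inj {u v x y : List Symbol} (hu : Balanced u) (hv : Balanced v)
    (h : u ++ .rpar :: x = v ++ .rpar :: y) : u = v ∧ x = y := by
  have key : ∀ {u v x y : List Symbol}, Balanced u → Balanced v →
      u ++ .rpar :: x = v ++ .rpar :: y → ¬ u.length < v.length := by
    intro u v x y hu hv h hlt
    have h' := congrArg (List.take (u.length + 1)) h
    rw [List.take_append_of_le_length (l₁ := v) (by omega), List.take_append,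
      List.take_of_length_le (by omega), Nat.add_sub_cancel_left] at h'
    have h2 := hv.2 (u.length + 1)
    rw [← h'] at h2
    simp [hu.1, Symbol.paren] at h2
  have hl : u.length = v.length := by
    have h1 := key hu hv h
    have h2 := key hv hu h.symm
    omega
  have := List.append_inj h hl
  simpa using this

lemma digits_append_inj {A A' s s' : List Symbol} (hA : ∀ a ∈ A, a.IsDigit)
    (hA' : ∀ a ∈ A', a.IsDigit) (hs : ∀ a ∈ s.head?, ¬ a.IsDigit)
    (hs' : ∀ a ∈ s'.head?, ¬ a.IsDigit) (h : A ++ s = A' ++ s') : A = A' ∧ s = s' := by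
  induction A generalizing A' with
  | nil =>
    cases A' with
    | nil => exact ⟨rfl, h⟩
    | cons a A' =>
      simp only [List.nil_append] at h
      subst h
      exact absurd (hA' a (by simp)) (hs a (by simp))
  | cons a A ih =>
    cases A' with
    | nil =>
      simp only [List.nil_append] at h
      subst h
      exact absurd (hA a (by simp)) (hs' a (by simp))
    | cons b A' =>
      simp only [List.cons_append, List.cons.injEq] at h
      obtain ⟨h1, h2⟩ := ih (fun x hx => hA x (by simp [hx])) (fun x hx => hA' x (by simp [hx])) h.2
      exact ⟨by rw [h.1, h1], h2⟩

/-- Parsing is deterministic: the first symbol decides the rule, balance locates the closing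
parenthesis, and the count is the maximal run of digits after the star. -/
lemma Expands.unique {s t t' : List Symbol} (h : Expands s t) (h' : Expands s t') : t = t' := by
  induction h generalizing t' with
  | nil => cases h'; rfl
  | plain a s t ha _ ih =>
    cases h' with
    | plain _ _ t' _ h => rw [ih h]
    | rep => exact absurd ha (by simp [Symbol.IsPlain])
  | rep k u u' s t hk hu hs hd ihu ihs =>
    generalize hw : Symbol.lpar :: (u ++ .rpar :: .star :: (natBin k ++ s)) = w at h'
    cases h' with
    | nil => simp at hw
    | plain a s t ha _ =>
      simp only [List.cons.injEq] at hw
      rw [← hw.1] at ha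
      exact absurd ha (by simp [Symbol.IsPlain])
    | rep k₂ u₂ u₂' s₂ t₂ hk₂ hu₂ hs₂ hd₂ =>
      simp only [List.cons.injEq, true_and] at hw
      obtain ⟨rfl, h2⟩ := hu.balanced.append_rpar_inj hu₂.balanced hw
      simp only [List.cons.injEq, true_and] at h2
      obtain ⟨h3, rfl⟩ := digits_append_inj (fun _ => isDigit_of_mem_natBin)
        (fun _ => isDigit_of_mem_natBin) hd hd₂ h2
      rw [natBin_injective h3, ihu hu₂, ihs hs₂]

/-- A leading digit of `s'` could be absorbed into a repetition count at the end of `s`; this is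
what `hd` excludes. -/
lemma Expands.append {s t s' t' : List Symbol} (h : Expands s t) (h' : Expands s' t')
    (hd : ∀ a ∈ s'.head?, ¬ a.IsDigit) : Expands (s ++ s') (t ++ t') := by
  induction h with
  | nil => simpa using h'
  | plain a s t ha _ ih => exact .plain _ _ _ ha ih
  | rep k u u' s t hk hu hs hs' _ ih =>
    have := Expands.rep k u u' (s ++ s') (t ++ t') hk hu ih (by cases s <;> simp_all)
    simpa [List.append_assoc] using this

lemma Expands.refl_of_isPlain {s : List Symbol} (h : ∀ a ∈ s, a.IsPlain) : Expands s s := by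
  induction s with
  | nil => exact .nil
  | cons a s ih => exact .plain _ _ _ (h a (by simp)) (ih fun b hb => h b (by simp [hb]))

/-! ## The full encoding determines the network -/

/-- The tokens, each preceded by a comma. -/
def commaJoin (ts : List (List Symbol)) : List Symbol := (ts.map (Symbol.comma :: ·)).flatten

@[simp] lemma commaJoin_nil : commaJoin [] = [] := rfl

@[simp] lemma commaJoin_cons (t : List Symbol) (ts : List (List Symbol)) :
    commaJoin (t :: ts) = .comma :: (t ++ commaJoin ts) := rfl

@[simp] lemma commaJoin_append (s t : List (List Symbol)) :
    commaJoin (s ++ t) = commaJoin s ++ commaJoin t := by simp [commaJoin]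

/-- Putting the comma before each token makes concatenation of token lists into concatenation of
symbols. It also makes every nonempty piece start with a non-digit, as `Expands.append` requires.
Only the very first token has to be treated separately. -/
lemma intercalate_comma_cons (t : List Symbol) (ts : List (List Symbol)) :
    List.intercalate [.comma] (t :: ts) = t ++ commaJoin ts := by
  induction ts generalizing t with
  | nil => simp
  | cons a ts ih => rw [List.intercalate_cons_cons, ih]; simp

lemma append_cons_inj_iff {α : Type*} {A A' B B' : List α} {x : α} (h : x ∉ A) (h' : x ∉ A') :
    A ++ x :: B = A' ++ x :: B' ↔ A = A' ∧ B = B' := by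
  refine ⟨fun e => ?_, fun e => by rw [e.1, e.2]⟩
  induction A generalizing A' with
  | nil =>
    cases A' with
    | nil => exact ⟨rfl, (List.cons.inj e).2⟩
    | cons a' A' => exact absurd (by rw [(List.cons.inj e).1]; simp) h'
  | cons a A ih =>
    cases A' with
    | nil => exact absurd (by rw [← (List.cons.inj e).1]; simp) h
    | cons a' A' =>
      simp only [List.cons_append, List.cons.injEq, List.mem_cons, not_or] at e h h'
      obtain ⟨h1, h2⟩ := ih h.2 h'.2 e.2
      exact ⟨by rw [e.1, h1], h2⟩

lemma append_commaJoin_inj {t t' : List Symbol} {ts ts' : List (List Symbol)}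
    (ht : .comma ∉ t) (ht' : .comma ∉ t') (hts : ∀ s ∈ ts, .comma ∉ s)
    (hts' : ∀ s ∈ ts', .comma ∉ s) (h : t ++ commaJoin ts = t' ++ commaJoin ts') :
    t = t' ∧ ts = ts' := by
  induction ts generalizing t t' ts' with
  | nil =>
    cases ts' with
    | nil => simpa using h
    | cons a ts' =>
      refine absurd ?_ ht
      simp only [commaJoin_nil, List.append_nil] at h
      simp [h]
  | cons b ts ih =>
    cases ts' with
    | nil =>
      refine absurd ?_ ht'
      simp only [commaJoin_nil, List.append_nil] at h
      simp [← h]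
    | cons a ts' =>
      simp only [commaJoin_cons] at h
      obtain ⟨h1, h2⟩ := (append_cons_inj_iff ht ht').1 h
      obtain ⟨h3, h4⟩ := ih (hts _ (by simp)) (hts' _ (by simp)) (fun s hs => hts _ (by simp [hs]))
        (fun s hs => hts' _ (by simp [hs])) h2
      exact ⟨h1, by rw [h3, h4]⟩

/-- The tokens of the entries of a matrix, row by row. -/
def matrixTokens {m n : ℕ} (W : Matrix (Fin m) (Fin n) ℤ) : List (List Symbol) :=
  (List.ofFn fun i => List.ofFn fun j => intBin (W i j)).flatten

/-- The tokens of the entries of a vector. -/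
def vectorTokens {m : ℕ} (b : Fin m → ℤ) : List (List Symbol) := List.ofFn fun i => intBin (b i)

/-- The tokens of one layer. -/
def layerTokens {m n : ℕ} (W : Matrix (Fin m) (Fin n) ℤ) (b : Fin m → ℤ) : List (List Symbol) :=
  [.wgt] :: (matrixTokens W ++ [.bias] :: vectorTokens b)

lemma Layers.tokens_last {m n : ℕ} (W : Matrix (Fin m) (Fin n) ℤ) (b : Fin m → ℤ) :
    (Layers.last W b).tokens = layerTokens W b := by
  simp [Layers.tokens, layerTokens, matrixTokens, vectorTokens]

lemma Layers.tokens_cons {m n k : ℕ} (W : Matrix (Fin k) (Fin n) ℤ) (b : Fin k → ℤ)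
    (rest : Layers k m) : (Layers.cons W b rest).tokens = layerTokens W b ++ rest.tokens := by
  simp [Layers.tokens, layerTokens, matrixTokens, vectorTokens]

lemma mem_matrixTokens {m n : ℕ} {W : Matrix (Fin m) (Fin n) ℤ} {t : List Symbol}
    (ht : t ∈ matrixTokens W) : ∃ i j, intBin (W i j) = t := by
  simpa [matrixTokens, List.mem_ofFn] using ht

lemma mem_vectorTokens {m : ℕ} {b : Fin m → ℤ} {t : List Symbol}
    (ht : t ∈ vectorTokens b) : ∃ i, intBin (b i) = t := by
  simpa [vectorTokens, List.mem_ofFn] using ht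

lemma length_matrixTokens {m n : ℕ} (W : Matrix (Fin m) (Fin n) ℤ) :
    (matrixTokens W).length = m * n := by
  simp [matrixTokens, List.length_flatten, Function.comp_def]

@[simp] lemma length_vectorTokens {m : ℕ} (b : Fin m → ℤ) : (vectorTokens b).length = m := by
  simp [vectorTokens]

/-- The dimensions are part of the type, so all rows have known length and flattening loses nothing.
-/
lemma matrixTokens_injective {m n : ℕ} :
    Function.Injective (matrixTokens : Matrix (Fin m) (Fin n) ℤ → _) := by
  intro W W' h
  have h2 := List.eq_iff_flatten_eq.2 ⟨h, by simp [List.map_ofFn, Function.comp_def]⟩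
  ext i j
  have h3 := congrFun (List.ofFn_injective h2) i
  exact intBin_injective (congrFun (List.ofFn_injective h3) j)

lemma vectorTokens_injective {m : ℕ} :
    Function.Injective (vectorTokens : (Fin m → ℤ) → _) := by
  intro b b' h
  ext i
  exact intBin_injective (congrFun (List.ofFn_injective h) i)

lemma bias_notMem_matrixTokens {m n : ℕ} (W : Matrix (Fin m) (Fin n) ℤ) :
    [.bias] ∉ matrixTokens W := fun h => by
  obtain ⟨i, j, h⟩ := mem_matrixTokens h
  exact intBin_ne_singleton (by simp) (by simp [Symbol.IsDigit]) h

lemma wgt_notMem_vectorTokens {m : ℕ} (b : Fin m → ℤ) : [.wgt] ∉ vectorTokens b := fun h => by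
  obtain ⟨i, h⟩ := mem_vectorTokens h
  exact intBin_ne_singleton (by simp) (by simp [Symbol.IsDigit]) h

lemma Layers.tokens_eq_cons {n m : ℕ} (l : Layers n m) : ∃ ts, l.tokens = [.wgt] :: ts := by
  cases l
  · exact ⟨_, Layers.tokens_last _ _⟩
  · exact ⟨_, Layers.tokens_cons _ _ _⟩

/-- The markers for weights and biases never occur among integer tokens, so they delimit the pieces.
The entries can be matched only once the hidden dimension is recovered. -/
lemma Layers.tokens_injective {n m : ℕ} :
    Function.Injective (Layers.tokens : Layers n m → _) := by
  intro l l' h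
  induction l with
  | last W b =>
    cases l' with
    | last W' b' =>
      simp only [Layers.tokens_last, layerTokens, List.cons.injEq, true_and] at h
      obtain ⟨h1, h2⟩ := (append_cons_inj_iff (bias_notMem_matrixTokens _)
        (bias_notMem_matrixTokens _)).1 h
      rw [matrixTokens_injective h1, vectorTokens_injective h2]
    | cons W' b' r' =>
      simp only [Layers.tokens_last, Layers.tokens_cons, layerTokens, List.cons.injEq, true_and,
        List.cons_append, List.append_assoc] at h
      obtain ⟨h1, h2⟩ := (append_cons_inj_iff (bias_notMem_matrixTokens _)
        (bias_notMem_matrixTokens _)).1 h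
      obtain ⟨ts, hts⟩ := r'.tokens_eq_cons
      exact absurd (by rw [h2, hts]; simp) (wgt_notMem_vectorTokens b)
  | cons W b r ih =>
    cases l' with
    | last W' b' =>
      simp only [Layers.tokens_last, Layers.tokens_cons, layerTokens, List.cons.injEq, true_and,
        List.cons_append, List.append_assoc] at h
      obtain ⟨h1, h2⟩ := (append_cons_inj_iff (bias_notMem_matrixTokens _)
        (bias_notMem_matrixTokens _)).1 h
      obtain ⟨ts, hts⟩ := r.tokens_eq_cons
      exact absurd (by rw [← h2, hts]; simp) (wgt_notMem_vectorTokens b')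
    | cons W' b' r' =>
      simp only [Layers.tokens_cons, layerTokens, List.cons.injEq, true_and,
        List.cons_append, List.append_assoc] at h
      obtain ⟨h1, h2⟩ := (append_cons_inj_iff (bias_notMem_matrixTokens _)
        (bias_notMem_matrixTokens _)).1 h
      obtain ⟨ts, hts⟩ := r.tokens_eq_cons
      obtain ⟨ts', hts'⟩ := r'.tokens_eq_cons
      have h3 := h2
      rw [hts, hts'] at h3
      have h4 := ((append_cons_inj_iff (wgt_notMem_vectorTokens _)
        (wgt_notMem_vectorTokens _)).1 h3).1
      -- The number of bias entries reveals the hidden dimension; after identifying the two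
      -- dimensions the weight matrices have the same type.
      have hk := congrArg List.length h4
      simp only [length_vectorTokens] at hk
      subst hk
      rw [h4, List.append_cancel_left_eq] at h2
      rw [matrixTokens_injective h1, vectorTokens_injective h4, ih h2]

/-- The tokens of the input vector. -/
def inputTokens {m : ℕ} (s : Fin m → Option ℤ) : List (List Symbol) :=
  List.ofFn fun p => slotToken (s p)

lemma mem_inputTokens {m : ℕ} {s : Fin m → Option ℤ} {t : List Symbol}
    (ht : t ∈ inputTokens s) : ∃ i, slotToken (s i) = t := by
  simpa [inputTokens, List.mem_ofFn] using ht

/-- A symbol that may occur in a token. -/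
def Symbol.IsTokenSymbol (a : Symbol) : Prop := a.IsPlain ∧ a ≠ .comma

lemma isTokenSymbol_intBin {z : ℤ} {a : Symbol} (ha : a ∈ intBin z) : a.IsTokenSymbol := by
  rcases mem_intBin ha with rfl | h
  · simp [Symbol.IsTokenSymbol, Symbol.IsPlain]
  · cases a <;> simp_all [Symbol.IsTokenSymbol, Symbol.IsPlain, Symbol.IsDigit]

lemma isTokenSymbol_inputTokens {m : ℕ} {s : Fin m → Option ℤ} {t : List Symbol}
    (ht : t ∈ inputTokens s) {a : Symbol} (ha : a ∈ t) : a.IsTokenSymbol := by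
  obtain ⟨i, rfl⟩ := mem_inputTokens ht
  cases h : s i with
  | none =>
    rw [h] at ha
    simp only [slotToken, List.mem_singleton] at ha
    subst ha
    simp [Symbol.IsTokenSymbol, Symbol.IsPlain]
  | some c => rw [h] at ha; exact isTokenSymbol_intBin ha

lemma isTokenSymbol_layerTokens {m n : ℕ} {W : Matrix (Fin m) (Fin n) ℤ} {b : Fin m → ℤ}
    {t : List Symbol} (ht : t ∈ layerTokens W b) {a : Symbol} (ha : a ∈ t) : a.IsTokenSymbol := by
  simp only [layerTokens, List.mem_cons, List.mem_append] at ht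
  rcases ht with rfl | h | rfl | h
  · simp only [List.mem_singleton] at ha; subst ha; simp [Symbol.IsTokenSymbol, Symbol.IsPlain]
  · obtain ⟨i, j, rfl⟩ := mem_matrixTokens h; exact isTokenSymbol_intBin ha
  · simp only [List.mem_singleton] at ha; subst ha; simp [Symbol.IsTokenSymbol, Symbol.IsPlain]
  · obtain ⟨i, rfl⟩ := mem_vectorTokens h; exact isTokenSymbol_intBin ha

lemma Layers.isTokenSymbol_tokens {m n : ℕ} {l : Layers n m}
    {t : List Symbol} (ht : t ∈ l.tokens) {a : Symbol} (ha : a ∈ t) : a.IsTokenSymbol := by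
  induction l with
  | last W b => rw [Layers.tokens_last] at ht; exact isTokenSymbol_layerTokens ht ha
  | cons W b r ih =>
    rw [Layers.tokens_cons, List.mem_append] at ht
    exact ht.elim (fun h => isTokenSymbol_layerTokens h ha) ih

/-- All tokens of a network. -/
def Network.tokens {I : ℕ} (F : Network I) : List (List Symbol) :=
  inputTokens F.input ++ F.layers.tokens

lemma Network.encode_eq {I : ℕ} (F : Network I) :
    F.encode = List.intercalate [.comma] F.tokens := rfl

lemma Network.isTokenSymbol_tokens {I : ℕ} {F : Network I}
    {t : List Symbol} (ht : t ∈ F.tokens) {a : Symbol} (ha : a ∈ t) : a.IsTokenSymbol :=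
  (List.mem_append.1 ht).elim (fun h => isTokenSymbol_inputTokens h ha)
    fun h => Layers.isTokenSymbol_tokens h ha

lemma Network.tokens_ne_nil {I : ℕ} (F : Network I) : F.tokens ≠ [] := by
  obtain ⟨ts, h⟩ := F.layers.tokens_eq_cons
  simp [Network.tokens, h]

lemma Network.tokens_injective {I : ℕ} : Function.Injective (Network.tokens : Network I → _) := by
  rintro ⟨n, s, hs, l⟩ ⟨n', s', hs', l'⟩ h
  simp only [Network.tokens] at h
  obtain ⟨ts, hts⟩ := l.tokens_eq_cons
  obtain ⟨ts', hts'⟩ := l'.tokens_eq_cons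
  have aux : ∀ {m : ℕ} (s : Fin m → Option ℤ), [.wgt] ∉ inputTokens s := fun s h => by
    obtain ⟨i, h⟩ := mem_inputTokens h
    exact slotToken_ne_wgt _ h
  have h3 := h
  rw [hts, hts'] at h3
  have h4 := ((append_cons_inj_iff (aux s) (aux s')).1 h3).1
  have hk : n = n' := by simpa [inputTokens] using congrArg List.length h4
  subst hk
  rw [h4, List.append_cancel_left_eq] at h
  obtain rfl := Layers.tokens_injective h
  have : s = s' := by
    ext1 i
    exact slotToken_injective (congrFun (List.ofFn_injective h4) i)
  subst this
  rfl

lemma Network.encode_injective {I : ℕ} : Function.Injective (Network.encode : Network I → _) := by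
  intro F G h
  rw [Network.encode_eq, Network.encode_eq] at h
  apply Network.tokens_injective
  have hF := fun t (ht : t ∈ F.tokens) (hc : Symbol.comma ∈ t) => (F.isTokenSymbol_tokens ht hc).2 rfl
  have hG := fun t (ht : t ∈ G.tokens) (hc : Symbol.comma ∈ t) => (G.isTokenSymbol_tokens ht hc).2 rfl
  obtain ⟨t, ts, e⟩ := List.exists_cons_of_ne_nil F.tokens_ne_nil
  obtain ⟨t', ts', e'⟩ := List.exists_cons_of_ne_nil G.tokens_ne_nil
  rw [e] at hF h ⊢
  rw [e'] at hG h ⊢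
  rw [intercalate_comma_cons, intercalate_comma_cons] at h
  obtain ⟨h1, h2⟩ := append_commaJoin_inj (hF _ (by simp)) (hG _ (by simp))
    (fun s hs => hF _ (by simp [hs])) (fun s hs => hG _ (by simp [hs])) h
  rw [h1, h2]

/-! ### Shortest descriptions and the number of networks that have a short one. -/

/-- The full encoding contains no repetition symbols and describes `F`, so the infimum is over a
nonempty set and is attained. -/
lemma Network.exists_describes {I : ℕ} (F : Network I) :
    ∃ s, Describes s F ∧ s.length = F.descLength := by
  have hne : {l | ∃ s : List Symbol, Describes s F ∧ s.length = l}.Nonempty := by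
    refine ⟨_, F.encode, Expands.refl_of_isPlain ?_, rfl⟩
    have h := fun t (ht : t ∈ F.tokens) a (ha : a ∈ t) => (F.isTokenSymbol_tokens ht ha).1
    rw [Network.encode_eq]
    obtain ⟨t, ts, e⟩ := List.exists_cons_of_ne_nil F.tokens_ne_nil
    rw [e] at h ⊢
    rw [intercalate_comma_cons]
    intro a ha
    rcases List.mem_append.1 ha with ha | ha
    · exact h t (by simp) a ha
    · simp only [commaJoin, List.mem_flatten, List.mem_map] at ha
      obtain ⟨_, ⟨u, hu, rfl⟩, ha⟩ := ha
      rcases List.mem_cons.1 ha with rfl | ha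
      · trivial
      · exact h u (by simp [hu]) a ha
  exact Nat.sInf_mem hne

lemma Network.descLength_le {I : ℕ} {F : Network I} {s : List Symbol} (h : Describes s F) :
    F.descLength ≤ s.length := Nat.sInf_le ⟨s, h, rfl⟩

/-- Code number of a symbol. -/
def Symbol.toFin : Symbol → Fin 10
  | .inp => 0 | .comma => 1 | .minus => 2 | .zero => 3 | .one => 4
  | .lpar => 5 | .rpar => 6 | .star => 7 | .wgt => 8 | .bias => 9

lemma Symbol.toFin_injective : Function.Injective Symbol.toFin := by
  intro a b h
  cases a <;> cases b <;> first | rfl | simp [Symbol.toFin] at h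

/-- There are at most `11 ^ S` networks of description length at most `S`. -/
lemma exists_injOn_descLength_le (I S : ℕ) :
    ∃ f : Network I → (Fin S → Option (Fin 10)), Set.InjOn f {F | F.descLength ≤ S} := by
  choose s hs hl using fun F : Network I => F.exists_describes
  -- A shortest description is padded with `none` to length exactly `S`; ten symbols and the padding
  -- make eleven values per position.
  refine ⟨fun F i => ((s F)[(i : ℕ)]?).map Symbol.toFin, fun F hF G hG h => ?_⟩
  have key : s F = s G := by
    apply List.ext_getElem?
    intro i
    by_cases hi : i < S
    · exact Option.map_injective Symbol.toFin_injective (congrFun h ⟨i, hi⟩)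
    · rw [List.getElem?_eq_none, List.getElem?_eq_none]
      · have := hl G; simp only [Set.mem_ofPred_eq] at hG; omega
      · have := hl F; simp only [Set.mem_ofPred_eq] at hF; omega
  have h1 := hs F
  have h2 := hs G
  rw [key] at h1
  exact Network.encode_injective (h1.unique h2)

/-! ## Consistent learning with a finite class -/

/-- If `f X` is a member of a family of at most `K` sets that contains no point of the sample `X`,
then the expected measure of `f X` is at most `(ln K + 1) / n`. -/
lemma measureReal_mem_le_of_consistent {α β : Type*} [MeasurableSpace α] [Finite α]
    [MeasurableSingletonClass α] [Fintype β] (μ : Measure α) [IsProbabilityMeasure μ] {n : ℕ}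
    (hn : 0 < n) (E : β → Set α) (f : (Fin n → α) → β) (hf : ∀ X i, X i ∉ E (f X)) :
    ((Measure.pi fun _ : Fin n => μ).prod μ).real {p : (Fin n → α) × α | p.2 ∈ E (f p.1)} ≤
      (Real.log (Fintype.card β) + 1) / n := by
  classical
  set ν := Measure.pi fun _ : Fin n => μ with hν
  have hα : Nonempty α := nonempty_of_isProbabilityMeasure μ
  have hβ : Nonempty β := ⟨f fun _ => hα.some⟩
  have hK : (0 : ℝ) < Fintype.card β := by exact_mod_cast Fintype.card_pos
  have hn' : (0 : ℝ) < n := by exact_mod_cast hn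
  -- The threshold is chosen so that `exp (-a n) = 1 / K`. The error is split into `a` and the
  -- excess over `a`, and the total expected excess will be at most `1 / n`.
  set a : ℝ := Real.log (Fintype.card β) / n with ha
  have ha0 : 0 ≤ a := div_nonneg (Real.log_nonneg (by exact_mod_cast Fintype.card_pos)) hn'.le
  have han : a * n = Real.log (Fintype.card β) := by rw [ha]; field_simp
  have hexp : Real.exp (-(a * n)) = (Fintype.card β : ℝ)⁻¹ := by
    rw [han, Real.exp_neg, Real.exp_log hK]
  let p : β → ℝ := fun b => μ.real (E b)
  let Z : β → Set (Fin n → α) := fun b => Set.univ.pi fun _ => (E b)ᶜ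
  have hZ : ∀ b, ν (Z b) ≤ ENNReal.ofReal (Real.exp (-(p b * n))) := by
    intro b
    have hc : μ (E b)ᶜ = ENNReal.ofReal (1 - p b) := by
      rw [← ofReal_measureReal, measureReal_compl (E b).toFinite.measurableSet]; simp [p]
    have h1 : 0 ≤ 1 - p b := sub_nonneg.2 measureReal_le_one
    simp only [Z, hν, Measure.pi_pi, hc, Finset.prod_const, Finset.card_univ, Fintype.card_fin]
    rw [← ENNReal.ofReal_pow h1]
    apply ENNReal.ofReal_le_ofReal
    calc (1 - p b) ^ n ≤ (Real.exp (-p b)) ^ n := by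
          apply pow_le_pow_left₀ h1
          have := Real.add_one_le_exp (-p b)
          linarith
      _ = Real.exp (-(p b * n)) := by rw [← Real.exp_nat_mul]; ring_nf
  -- With `t = n (p b - a)`, the inequality `t ≤ exp t` gives `(p b - a) exp (-p b n) ≤ exp (-a n) /
  -- n`, which is `1 / (K n)`.
  have hterm : ∀ b, ENNReal.ofReal (p b - a) * ν (Z b) ≤
      ENNReal.ofReal ((Fintype.card β : ℝ)⁻¹ / n) := by
    intro b
    refine (mul_le_mul_right (hZ b) _).trans ?_
    rw [← ENNReal.ofReal_mul' (Real.exp_nonneg _)]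
    apply ENNReal.ofReal_le_ofReal
    rw [le_div_iff₀ hn', ← hexp]
    have h1 := Real.add_one_le_exp (n * (p b - a))
    have h2 : Real.exp (-(a * n)) = Real.exp (n * (p b - a)) * Real.exp (-(p b * n)) := by
      rw [← Real.exp_add]; ring_nf
    rw [h2]
    nlinarith [Real.exp_pos (-(p b * n))]
  -- By consistency `X` lies in `Z (f X)`, so the excess is one term of the sum over all `b`. The
  -- sum no longer depends on the choice `f`.
  have hpt : ∀ X, μ (E (f X)) ≤ ENNReal.ofReal a +
      ∑ b, ENNReal.ofReal (p b - a) * (Z b).indicator 1 X := by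
    intro X
    have hX : X ∈ Z (f X) := fun i _ => hf X i
    calc μ (E (f X)) = ENNReal.ofReal (a + (p (f X) - a)) := by simp [p]
      _ ≤ ENNReal.ofReal a + ENNReal.ofReal (p (f X) - a) := ENNReal.ofReal_add_le
      _ = ENNReal.ofReal a + ENNReal.ofReal (p (f X) - a) * (Z (f X)).indicator 1 X := by simp [hX]
      _ ≤ _ := by
        gcongr
        exact Finset.single_le_sum (f := fun b => ENNReal.ofReal (p b - a) * (Z b).indicator 1 X)
          (fun _ _ => zero_le) (Finset.mem_univ (f X))
  rw [measureReal_def, Measure.prod_apply (Set.toFinite _).measurableSet]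
  apply ENNReal.toReal_le_of_le_ofReal (by positivity)
  have hm : ∀ g : (Fin n → α) → ENNReal, Measurable g := fun g => .of_discrete
  calc ∫⁻ X, μ (Prod.mk X ⁻¹' {p : (Fin n → α) × α | p.2 ∈ E (f p.1)}) ∂ν
      ≤ ∫⁻ X, (ENNReal.ofReal a + ∑ b, ENNReal.ofReal (p b - a) * (Z b).indicator 1 X) ∂ν :=
        lintegral_mono hpt
    _ = ENNReal.ofReal a + ∑ b, ENNReal.ofReal (p b - a) * ν (Z b) := by
        rw [lintegral_add_left (hm _), lintegral_finsetSum _ fun b _ => hm _]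
        simp [lintegral_const_mul _ (hm _), lintegral_indicator (Set.toFinite _).measurableSet]
    _ ≤ ENNReal.ofReal a + ∑ _b : β, ENNReal.ofReal ((Fintype.card β : ℝ)⁻¹ / n) := by
        gcongr with b
        exact hterm b
    _ = ENNReal.ofReal ((Real.log (Fintype.card β) + 1) / n) := by
        rw [← ENNReal.ofReal_sum_of_nonneg (fun _ _ => by positivity),
          ← ENNReal.ofReal_add ha0 (by positivity)]
        congr 1
        simp only [Finset.sum_const, Finset.card_univ, nsmul_eq_mul]
        rw [ha]; field_simp

/-! ## Sequences of rectified assignments -/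

/-- Affine expressions with integer coefficients in the coordinates `ι`. -/
inductive Lin (ι : Type) where
  | const (c : ℤ) : Lin ι
  | coord (i : ι) : Lin ι
  | add (f g : Lin ι) : Lin ι
  | smul (c : ℤ) (f : Lin ι) : Lin ι

namespace Lin

variable {ι : Type}

instance : Add (Lin ι) := ⟨Lin.add⟩

/-- The difference of two expressions. -/
instance : Sub (Lin ι) := ⟨fun f g => .add f (.smul (-1) g)⟩

/-- Value of an expression. -/
def eval (z : ι → ℤ) : Lin ι → ℤ
  | const c => c
  | coord i => z i
  | add f g => f.eval z + g.eval z
  | smul c f => c * f.eval z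

/-- Bound for the coefficients of an expression. -/
def weight : Lin ι → ℕ
  | const c => c.natAbs
  | coord _ => 1
  | add f g => f.weight + g.weight
  | smul c f => c.natAbs * f.weight

variable (z : ι → ℤ) (f g : Lin ι) (c : ℤ) (i : ι)

@[simp] lemma eval_const : (const c).eval z = c := rfl
@[simp] lemma eval_coord : (coord i).eval z = z i := rfl
@[simp] lemma eval_add : (f + g).eval z = f.eval z + g.eval z := rfl
@[simp] lemma eval_smul : (smul c f).eval z = c * f.eval z := rfl
@[simp] lemma eval_sub : (f - g).eval z = f.eval z - g.eval z := by
  change f.eval z + -1 * g.eval z = _; ring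
@[simp] lemma weight_const : (const c : Lin ι).weight = c.natAbs := rfl
@[simp] lemma weight_coord : (coord i).weight = 1 := rfl
@[simp] lemma weight_add : (f + g).weight = f.weight + g.weight := rfl
@[simp] lemma weight_smul : (smul c f).weight = c.natAbs * f.weight := rfl
@[simp] lemma weight_sub : (f - g).weight = f.weight + g.weight := by
  change f.weight + (-1 : ℤ).natAbs * g.weight = _; simp

end Lin

/-- The assignment `target ← max expr 0`. -/
structure Asg (ι : Type) where
  target : ι
  expr : Lin ι

/-- Effect of an assignment. -/
def Asg.run {ι : Type} [DecidableEq ι] (a : Asg ι) (z : ι → ℤ) : ι → ℤ :=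
  Function.update z a.target (max (a.expr.eval z) 0)

/-- Effect of a sequence of assignments. -/
def runAll {ι : Type} [DecidableEq ι] : List (Asg ι) → (ι → ℤ) → ι → ℤ
  | [], z => z
  | a :: l, z => runAll l (a.run z)

section
variable {ι : Type} [DecidableEq ι]

@[simp] lemma runAll_nil (z : ι → ℤ) : runAll [] z = z := rfl

@[simp] lemma runAll_cons (a : Asg ι) (l : List (Asg ι)) (z : ι → ℤ) :
    runAll (a :: l) z = runAll l (a.run z) := rfl

@[simp] lemma runAll_append (l l' : List (Asg ι)) (z : ι → ℤ) :
    runAll (l ++ l') z = runAll l' (runAll l z) := by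
  induction l generalizing z with
  | nil => rfl
  | cons a l ih => simp [ih]

lemma runAll_replicate_succ (m : ℕ) (l : List (Asg ι)) (z : ι → ℤ) :
    runAll (List.replicate (m + 1) l).flatten z =
      runAll l (runAll (List.replicate m l).flatten z) := by
  rw [List.replicate_succ', List.flatten_append, runAll_append]
  simp

end

/-! ## Compilation of simple neural programs -/

/-- Coordinates of the compiled program: the variables, two temporaries, and for each nesting depth
the flag that says whether the current block is active, the number of repetitions that are left, and
the next value of the loop counter. -/
inductive Coord (V T : ℕ) where
  | var (v : Fin V)
  | tmpA
  | tmpB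
  | gate (d : Fin T)
  | count (d : Fin T)
  | next (d : Fin T)
deriving DecidableEq

variable {V T : ℕ}

/-- The expression for an operand. -/
def Operand.lin : Operand V → Lin (Coord V T)
  | .const c => .const c
  | .var v => .coord (.var v)

/-- The values of the program variables. -/
def vars (z : Coord V T → ℤ) : Fin V → ℤ := fun v => z (.var v)

@[simp] lemma Operand.eval_lin (a : Operand V) (z : Coord V T → ℤ) :
    (a.lin : Lin (Coord V T)).eval z = a.eval (vars z) := by
  cases a <;> rfl

open Lin Coord in
/-- Code that puts `1` into `tmpA` if the comparison holds, and `0` otherwise. -/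
def Cmp.code (x y : Lin (Coord V T)) : Cmp → List (Asg (Coord V T))
  | .eq => [⟨tmpA, x - y⟩, ⟨tmpB, y - x⟩, ⟨tmpA, const 1 - coord tmpA - coord tmpB⟩]
  | .le => [⟨tmpA, x - y⟩, ⟨tmpA, const 1 - coord tmpA⟩]
  | .lt => [⟨tmpA, x + const 1 - y⟩, ⟨tmpA, const 1 - coord tmpA⟩]
  | .ge => [⟨tmpA, y - x⟩, ⟨tmpA, const 1 - coord tmpA⟩]
  | .gt => [⟨tmpA, y + const 1 - x⟩, ⟨tmpA, const 1 - coord tmpA⟩]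

open Lin Coord in
/-- Code that puts the value of a statement into `tmpA`; the number `M` exceeds all values. -/
def Cmd.valueCode (M : ℕ) : Cmd V → List (Asg (Coord V T))
  | .assign _ a => [⟨tmpA, a.lin⟩]
  | .ite _ c a b =>
    [⟨tmpA, a.lin + smul M (coord (.var c)) - const M⟩,
     ⟨tmpB, b.lin - smul M (coord (.var c))⟩, ⟨tmpA, coord tmpA + coord tmpB⟩]
  | .addConst _ i c => [⟨tmpA, coord (.var i) + const c⟩]
  | .mulConst _ c i => [⟨tmpA, smul c (coord (.var i))⟩]
  | .cmpConst _ r i c => r.code (coord (.var i)) (const c)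
  | .add _ i j => [⟨tmpA, coord (.var i) + coord (.var j)⟩]
  | .sub _ i j => [⟨tmpA, coord (.var i) - coord (.var j)⟩]
  | .cmp _ r i j => r.code (coord (.var i)) (coord (.var j))

open Lin Coord in
/-- Code that moves `tmpA` to the variable `k` if the flag of depth `d` is set. -/
def selectCode (M : ℕ) (d : Fin T) (k : Fin V) : List (Asg (Coord V T)) :=
  [⟨tmpB, coord tmpA + smul M (coord (gate d)) - const M⟩,
   ⟨.var k, coord (.var k) - smul M (coord (gate d))⟩,
   ⟨.var k, coord (.var k) + coord tmpB⟩]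

/-- Code for a statement in a block of depth `d`. -/
def Cmd.code (M : ℕ) (d : Fin T) (c : Cmd V) : List (Asg (Coord V T)) :=
  c.valueCode M ++ selectCode M d c.target

open Lin Coord in
/-- Code that prepares a loop inside a block of depth `d`; the loop has depth `d'`. -/
def enterCode (M : ℕ) (d d' : Fin T) (s e : Operand V) : List (Asg (Coord V T)) :=
  [⟨tmpA, e.lin + const 1 - s.lin⟩,
   ⟨count d', coord tmpA + smul M (coord (gate d)) - const M⟩,
   ⟨next d', s.lin⟩]

open Lin Coord in
/-- Code at the beginning of each repetition of a loop of depth `d`. -/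
def repeatCode (M : ℕ) (d : Fin T) (i : Fin V) : List (Asg (Coord V T)) :=
  [⟨tmpA, const 1 - coord (count d)⟩, ⟨gate d, const 1 - coord tmpA⟩,
   ⟨count d, coord (count d) - const 1⟩, ⟨tmpA, coord (next d)⟩,
   ⟨next d, coord (next d) + const 1⟩] ++ selectCode M d i

/-- Code for a block of depth `d`; loops are repeated `K` times. -/
def Block.code [NeZero T] (M K : ℕ) : Block V → Fin T → List (Asg (Coord V T))
  | .done, _ => []
  | .cmd c rest, d => c.code M d ++ rest.code M K d
  | .loop i s e clause rest, d =>
    enterCode M d (d + 1) s e ++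
      ((List.replicate K (repeatCode M (d + 1) i ++ clause.code M K (d + 1))).flatten ++
        rest.code M K d)

/-! ## Correctness of the compilation -/

/-- For integers, `max (1 - max (x - y) 0) 0` is the indicator of `x ≤ y`; strict comparisons shift
by one, and equality subtracts both truncated differences from `1`. As `tmpA` is overwritten before
the second difference is formed, the expressions must not depend on it. -/
lemma Cmp.runAll_code (r : Cmp) (x y : Lin (Coord V T)) (z : Coord V T → ℤ)
    (hx : ∀ t, x.eval (Function.update z .tmpA t) = x.eval z)
    (hy : ∀ t, y.eval (Function.update z .tmpA t) = y.eval z) :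
    runAll (r.code x y) z .tmpA = (if r.test (x.eval z) (y.eval z) then 1 else 0) ∧
      ∀ i, i ≠ .tmpA → i ≠ .tmpB → runAll (r.code x y) z i = z i := by
  cases r <;> refine ⟨?_, fun i h1 h2 => ?_⟩ <;>
    simp [Cmp.code, Asg.run, Cmp.test, *] <;> split_ifs <;> omega

/-- All values are between `0` and `B`. -/
def InRange (B : ℕ) (σ : Fin V → ℤ) : Prop := ∀ v, 0 ≤ σ v ∧ σ v ≤ B

lemma Operand.eval_mem {B : ℕ} {σ : Fin V → ℤ} (hσ : InRange B σ) {a : Operand V}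
    (ha : a.ConstLe B) : 0 ≤ a.eval σ ∧ a.eval σ ≤ B := by
  cases a with
  | const c => simpa [Operand.eval, Operand.ConstLe] using ha
  | var v => exact hσ v

lemma vars_update_of_ne {z : Coord V T → ℤ} {i : Coord V T} (t : ℤ) (h : ∀ v, i ≠ .var v) :
    vars (Function.update z i t) = vars z := by
  ext v
  simp [vars, (h v).symm]

/-- In the conditional, the branch not taken has `M` subtracted and is rectified to zero, so adding
the two branches selects. The value is only obtained truncated at zero: in an inactive block it may
be negative, and there it is discarded. -/
lemma Cmd.runAll_valueCode {B M : ℕ} (hM : 2 * B ≤ M) (c : Cmd V) (z : Coord V T → ℤ)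
    (hz : InRange B (vars z)) {isBool : Fin V → Prop} (hc : c.ConstLe B)
    (hw : c.WellFormed isBool) (hb : ∀ v, isBool v → vars z v ≤ 1) :
    runAll (c.valueCode M) z .tmpA = max (c.value (vars z)) 0 ∧
      ∀ i, i ≠ .tmpA → i ≠ .tmpB → runAll (c.valueCode M) z i = z i := by
  cases c with
  | assign k a => simp +contextual [Cmd.valueCode, Asg.run, Cmd.value]
  | ite k c a b =>
    have ha := Operand.eval_mem hz hc.1
    have hb' := Operand.eval_mem hz hc.2
    have h1 := hb c hw
    have h0 := (hz c).1
    refine ⟨?_, fun i h1 h2 => ?_⟩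
    · have : vars z c = 0 ∨ vars z c = 1 := by omega
      simp only [Cmd.valueCode, Asg.run, Cmd.value, runAll_cons, runAll_nil, Lin.eval_sub,
        Lin.eval_add, Operand.eval_lin, Lin.eval_smul, Lin.eval_const, Lin.eval_coord,
        Function.update_self]
      rw [vars_update_of_ne _ (by simp)]
      simp only [ne_eq, reduceCtorEq, not_false_eq_true, Function.update_of_ne, Function.update_self]
      change max (max (_ + _ * vars z c - _) _ + max (_ - _ * vars z c) _) _ = _
      rcases this with h | h <;> rw [h] <;> simp <;> omega
    · simp [Cmd.valueCode, Asg.run, *]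
  | addConst k i c => simp +contextual [Cmd.valueCode, Asg.run, Cmd.value, vars]
  | mulConst k c i => simp +contextual [Cmd.valueCode, Asg.run, Cmd.value, vars]
  | cmpConst k r i c =>
    have := r.runAll_code (.coord (.var i)) (.const c) z (by simp) (by simp)
    refine ⟨?_, this.2⟩
    rw [Cmd.valueCode, this.1]
    simp only [Cmd.value, Lin.eval_coord, Lin.eval_const, vars]
    by_cases h : r.test (z (.var i)) c = true <;> simp [h]
  | add k i j => simp +contextual [Cmd.valueCode, Asg.run, Cmd.value, vars]
  | sub k i j => simp +contextual [Cmd.valueCode, Asg.run, Cmd.value, vars]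
  | cmp k r i j =>
    have := r.runAll_code (.coord (.var i)) (.coord (.var j)) z (by simp) (by simp)
    refine ⟨?_, this.2⟩
    rw [Cmd.valueCode, this.1]
    simp only [Cmd.value, Lin.eval_coord, vars]
    by_cases h : r.test (z (.var i)) (z (.var j)) = true <;> simp [h]

/-- With the flag set, subtracting `M` erases the old value of `k` and `tmpB` carries `tmpA`; with
the flag clear, `tmpB` is rectified to zero and `k` survives. Both cases need the values to be at
most `M`. -/
lemma runAll_selectCode {M : ℕ} (d : Fin T) (k : Fin V) (z : Coord V T → ℤ)
    (hA : 0 ≤ z .tmpA) (hA' : z .tmpA ≤ M) (hk : 0 ≤ z (.var k)) (hk' : z (.var k) ≤ M)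
    (hg : z (.gate d) = 0 ∨ z (.gate d) = 1) :
    runAll (selectCode M d k) z (.var k) = (if z (.gate d) = 1 then z .tmpA else z (.var k)) ∧
      ∀ i, i ≠ .var k → i ≠ .tmpB → runAll (selectCode M d k) z i = z i := by
  refine ⟨?_, fun i h1 h2 => ?_⟩
  · rcases hg with h | h <;> simp [selectCode, Asg.run, h, hA, hk, hA', hk']
  · simp [selectCode, Asg.run, *]

/-- Inactive code also computes values, about which boundedness of the program says nothing. One
operation on quantities up to `B` stays below `B²`, where products are the worst case and `B ≥ 2`
takes care of sums. -/
lemma Cmd.value_le {B M : ℕ} (hB : 2 ≤ B) (hM : B * B ≤ M) {c : Cmd V} {σ : Fin V → ℤ}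
    (hσ : InRange B σ) (hc : c.ConstLe B) : c.value σ ≤ M := by
  have hM' : (B : ℤ) * B ≤ M := by exact_mod_cast hM
  have h2B : (2 : ℤ) * B ≤ M := by nlinarith [(by exact_mod_cast hB : (2 : ℤ) ≤ B)]
  have hB' : (2 : ℤ) ≤ B := by exact_mod_cast hB
  cases c with
  | assign k a => have := Operand.eval_mem hσ hc; simp only [Cmd.value]; omega
  | ite k c a b =>
    have := Operand.eval_mem hσ hc.1
    have := Operand.eval_mem hσ hc.2
    simp only [Cmd.value]; split_ifs <;> omega
  | addConst k i c =>
    have := hσ i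
    simp only [Cmd.ConstLe] at hc
    simp only [Cmd.value]; omega
  | mulConst k c i =>
    have := hσ i
    simp only [Cmd.ConstLe] at hc
    have hc' : (c : ℤ) ≤ B := by exact_mod_cast hc
    simp only [Cmd.value]; nlinarith
  | cmpConst k r i c => simp only [Cmd.value]; split_ifs <;> omega
  | add k i j => have := hσ i; have := hσ j; simp only [Cmd.value]; omega
  | sub k i j => have := hσ i; have := hσ j; simp only [Cmd.value]; omega
  | cmp k r i j => simp only [Cmd.value]; split_ifs <;> omega

/-- The states `z` and `z'` agree on the control coordinates of depth at most `d`. -/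
def AgreeUpTo (d : Fin T) (z z' : Coord V T → ℤ) : Prop :=
  ∀ d' ≤ d, z (.gate d') = z' (.gate d') ∧ z (.count d') = z' (.count d') ∧
    z (.next d') = z' (.next d')

lemma AgreeUpTo.trans {d : Fin T} {z z' z'' : Coord V T → ℤ} (h : AgreeUpTo d z z')
    (h' : AgreeUpTo d z' z'') : AgreeUpTo d z z'' := fun d' hd =>
  ⟨(h d' hd).1.trans (h' d' hd).1, (h d' hd).2.1.trans (h' d' hd).2.1,
    (h d' hd).2.2.trans (h' d' hd).2.2⟩

lemma AgreeUpTo.mono {d e : Fin T} {z z' : Coord V T → ℤ} (h : AgreeUpTo e z z') (hd : d ≤ e) :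
    AgreeUpTo d z z' := fun d' hd' => h d' (hd'.trans hd)

/-- A state that a run may produce: values in range, boolean variables at most `1`. -/
def Ok (isBool : Fin V → Prop) (B : ℕ) (σ : Fin V → ℤ) : Prop :=
  ∀ v, 0 ≤ σ v ∧ σ v ≤ B ∧ (isBool v → σ v ≤ 1)

lemma Ok.inRange {isBool : Fin V → Prop} {B : ℕ} {σ : Fin V → ℤ} (h : Ok isBool B σ) :
    InRange B σ := fun v => ⟨(h v).1, (h v).2.1⟩

lemma Cmd.runAll_code {B M : ℕ} (hB : 2 ≤ B) (hM : B * B ≤ M) (d : Fin T) (c : Cmd V)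
    (z : Coord V T → ℤ) {isBool : Fin V → Prop} (hz : Ok isBool B (vars z)) (hc : c.ConstLe B)
    (hw : c.WellFormed isBool) (hg : z (.gate d) = 0 ∨ z (.gate d) = 1)
    (hv : z (.gate d) = 1 → 0 ≤ c.value (vars z)) :
    vars (runAll (c.code M d) z) = (if z (.gate d) = 1 then c.exec (vars z) else vars z) ∧
      ∀ e, AgreeUpTo e z (runAll (c.code M d) z) := by
  have h2B : 2 * B ≤ M := by nlinarith
  obtain ⟨h1, h2⟩ := c.runAll_valueCode h2B z hz.inRange hc hw fun v => (hz v).2.2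
  have hle := Cmd.value_le hB hM hz.inRange hc
  have hk := hz c.target
  set z' := runAll (c.valueCode M) z with hz'
  have hvar : ∀ v, z' (.var v) = vars z v := fun v => h2 _ (by simp) (by simp)
  have hgate := h2 (.gate d) (by simp) (by simp)
  obtain ⟨h3, h4⟩ := runAll_selectCode (M := M) d c.target z' (by omega) (by omega)
    (by rw [hvar]; omega) (by rw [hvar]; omega) (by rw [hgate]; exact hg)
  simp only [Cmd.code, runAll_append, ← hz']
  refine ⟨?_, fun e d' _ => ?_⟩
  · ext v
    by_cases hvk : v = c.target
    · subst hvk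
      simp only [vars] at h3 ⊢
      rw [h3, hgate, h1]
      split_ifs with h
      · simp only [Cmd.exec, Function.update_self]; exact max_eq_left (hv h)
      · exact hvar _
    · have : vars (runAll (selectCode M d c.target) z') v = vars z v := by
        simp only [vars]
        rw [h4 _ (by simpa using hvk) (by simp)]
        exact hvar v
      rw [this]
      split_ifs
      · simp [Cmd.exec, hvk]
      · rfl
  · rw [h4 _ (by simp) (by simp), h4 _ (by simp) (by simp), h4 _ (by simp) (by simp),
      h2 _ (by simp) (by simp), h2 _ (by simp) (by simp), h2 _ (by simp) (by simp)]
    exact ⟨rfl, rfl, rfl⟩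


lemma loopState_ok {isBool : Fin V → Prop} {B : ℕ} {f : (Fin V → ℤ) → Fin V → ℤ} {i : Fin V} {a : ℤ}
    {σ : Fin V → ℤ} {R : ℕ} (hσ : Ok isBool B σ)
    (hf : ∀ m < R, Ok isBool B (f (Function.update (loopState f i a σ m) i (a + m)))) :
    ∀ m ≤ R, Ok isBool B (loopState f i a σ m) := by
  intro m hm
  cases m with
  | zero => exact hσ
  | succ m => exact hf m hm

lemma Block.ok_exec {isBool : Fin V → Prop} {B : ℕ} (b : Block V) {σ : Fin V → ℤ}
    (hσ : Ok isBool B σ) (h : b.AllStates (Ok isBool B) σ) : Ok isBool B (b.exec σ) := by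
  induction b generalizing σ with
  | done => exact hσ
  | cmd c rest ih => exact ih h.1 h.2
  | loop i s e clause rest ihc ihr =>
    exact ihr (loopState_ok hσ (fun m hm => ihc (h.1 m hm).1 (h.1 m hm).2) _ le_rfl) h.2

/-- The flag becomes the truncation `1 - max (1 - r) 0`, and the remaining count decreases but stops
at zero, so once the loop is exhausted all further copies are inactive. The value `next` keeps
growing in surplus copies, hence the separate bound `hn'`. -/
lemma runAll_repeatCode {B M : ℕ} (hM : B ≤ M) (d : Fin T) (i : Fin V) (z : Coord V T → ℤ)
    (hz : InRange B (vars z)) (r : ℕ) (hr : z (.count d) = r) (hn : 0 ≤ z (.next d))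
    (hn' : z (.next d) ≤ M) :
    vars (runAll (repeatCode M d i) z) =
        (if 0 < r then Function.update (vars z) i (z (.next d)) else vars z) ∧
      runAll (repeatCode M d i) z (.gate d) = (if 0 < r then 1 else 0) ∧
      runAll (repeatCode M d i) z (.count d) = (r - 1 : ℕ) ∧
      runAll (repeatCode M d i) z (.next d) = z (.next d) + 1 ∧
      ∀ e, e ≠ d → runAll (repeatCode M d i) z (.gate e) = z (.gate e) ∧
        runAll (repeatCode M d i) z (.count e) = z (.count e) ∧
        runAll (repeatCode M d i) z (.next e) = z (.next e) := by
  have hi := hz i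
  rw [repeatCode, runAll_append]
  set z' := runAll _ z with hz'
  have hA : z' .tmpA = z (.next d) := by simp [hz', Asg.run, hn]
  have hg : z' (.gate d) = if 0 < r then 1 else 0 := by
    simp [hz', Asg.run, hr]; split_ifs <;> omega
  have hc : z' (.count d) = (r - 1 : ℕ) := by simp [hz', Asg.run, hr]; omega
  have hx : z' (.next d) = z (.next d) + 1 := by simp [hz', Asg.run]; omega
  have hv : ∀ v, z' (.var v) = vars z v := by intro v; simp [hz', Asg.run, vars]
  have ho : ∀ e, e ≠ d → z' (.gate e) = z (.gate e) ∧ z' (.count e) = z (.count e) ∧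
      z' (.next e) = z (.next e) := by intro e he; simp [hz', Asg.run, he]
  obtain ⟨h3, h4⟩ := runAll_selectCode (M := M) d i z' (by omega) (by omega)
    (by rw [hv]; omega) (by rw [hv]; omega) (by rw [hg]; split_ifs <;> simp)
  refine ⟨?_, ?_, ?_, ?_, fun e he => ?_⟩
  · ext v
    by_cases hvi : v = i
    · subst hvi
      simp only [vars] at h3 ⊢
      rw [h3, hg, hA]
      by_cases h : 0 < r
      · simp [h]
      · simp only [h, if_false]; simpa [vars] using hv v
    · have : vars (runAll (selectCode M d i) z') v = vars z v := by
        simp only [vars]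
        rw [h4 _ (by simpa using hvi) (by simp)]
        exact hv v
      rw [this]
      split_ifs <;> simp [hvi]
  · rw [h4 _ (by simp) (by simp), hg]
  · rw [h4 _ (by simp) (by simp), hc]
  · rw [h4 _ (by simp) (by simp), hx]
  · rw [h4 _ (by simp) (by simp), h4 _ (by simp) (by simp), h4 _ (by simp) (by simp)]
    exact ho e he

/-- The code of a block executes the block if the flag of its depth is set, and leaves all variables
unchanged otherwise. -/
theorem Block.runAll_code [NeZero T] {B M : ℕ} (hB : 2 ≤ B) (hM : B * B ≤ M)
    {isBool : Fin V → Prop} (b : Block V) (d : Fin T) (z : Coord V T → ℤ)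
    (hz : Ok isBool B (vars z)) (hc : b.ConstLe B) (hw : b.WellFormed isBool)
    (hd : d.val + b.length < T) (hg : z (.gate d) = 0 ∨ z (.gate d) = 1)
    (hs : z (.gate d) = 1 → b.AllStates (Ok isBool B) (vars z)) :
    vars (runAll (b.code M (B + 1) d) z) =
        (if z (.gate d) = 1 then b.exec (vars z) else vars z) ∧
      AgreeUpTo d z (runAll (b.code M (B + 1) d) z) := by
  have h2B : 2 * B ≤ M := by nlinarith
  induction b generalizing d z with
  | done => simp [Block.code, Block.exec, AgreeUpTo]
  | cmd c rest ih =>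
    simp only [Block.code, runAll_append, Block.exec]
    obtain ⟨h1, h2⟩ := Cmd.runAll_code hB hM d c z hz hc.1 hw.1 hg fun h => by
      have := ((hs h).1 c.target).1
      simpa [Cmd.exec] using this
    simp only [Block.length] at hd
    have hgd := (h2 d d le_rfl).1
    obtain ⟨h3, h4⟩ := ih d (runAll (c.code M d) z)
      (by rw [h1]; split_ifs with h; exacts [(hs h).1, hz]) hc.2 hw.2 (by omega)
      (by rw [← hgd]; exact hg) (by
        rw [← hgd, h1]
        intro h
        rw [if_pos h]; exact (hs h).2)
    refine ⟨?_, (h2 d).trans h4⟩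
    rw [h3, h1, ← hgd]
    split_ifs <;> rfl
  | loop i s e clause rest ihc ihr =>
    obtain ⟨hcs, hce, hcc, hcr⟩ := hc
    obtain ⟨-, -, hwc, hwr⟩ := hw
    simp only [Block.length] at hd
    -- The room left by `hd` prevents the depth index from wrapping around in `Fin T`, so the inner
    -- loop has fresh control coordinates.
    have hd1 : (d + 1 : Fin T).val = d.val + 1 := by
      rw [Fin.val_add_one_of_lt' (by omega)]
    have hlt : d < d + 1 := by rw [Fin.lt_def]; omega
    simp only [Block.code, runAll_append, Block.exec]
    have hse := Operand.eval_mem hz.inRange hcs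
    have hee := Operand.eval_mem hz.inRange hce
    set f := clause.exec with hf
    set a := s.eval (vars z) with ha
    set σ := vars z with hσ
    -- `R` is the number of active copies. Setting it to zero in an inactive block treats both cases
    -- with one invariant. Since loop bounds lie in `[0, B]`, `B + 1` copies always suffice.
    obtain ⟨R, hR⟩ : ∃ R : ℕ, R = if z (.gate d) = 1 then repetitions a (e.eval σ) else 0 := ⟨_, rfl⟩
    have hRB : R ≤ B + 1 := by
      rw [hR]; split_ifs
      · simp only [repetitions]; omega
      · omega
    have hst : ∀ m < R, Ok isBool B (Function.update (loopState f i a σ m) i (a + m)) ∧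
        clause.AllStates (Ok isBool B) (Function.update (loopState f i a σ m) i (a + m)) := by
      intro m hm
      by_cases h : z (.gate d) = 1
      · rw [if_pos h] at hR
        exact (hs h).1 m (lt_of_lt_of_eq hm hR)
      · rw [if_neg h] at hR
        omega
    have hok := loopState_ok hz (fun m hm => clause.ok_exec (hst m hm).1 (hst m hm).2)
    -- the state before the first repetition
    set z₁ := runAll (enterCode M d (d + 1) s e) z with hz₁
    have hv₁ : vars z₁ = σ := by ext v; simp [hz₁, enterCode, Asg.run, vars, hσ]
    have hn₁ : z₁ (.next (d + 1)) = a := by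
      simp only [hz₁, enterCode, Asg.run, runAll_cons, runAll_nil, Function.update_self,
        Operand.eval_lin]
      rw [vars_update_of_ne _ (by simp), vars_update_of_ne _ (by simp)]
      exact max_eq_left hse.1
    have hc₁ : z₁ (.count (d + 1)) = R := by
      have : (if z (.gate d) = 1 then ((repetitions a (e.eval σ) : ℕ) : ℤ) else 0) = R := by
        rw [hR]; split_ifs <;> simp
      rw [← this]
      rcases hg with h | h <;>
        simp [hz₁, enterCode, Asg.run, h, repetitions, ← hσ, ← ha]
      omega
    have ha₁ : AgreeUpTo d z z₁ := by
      intro d' hd'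
      have hne : d' ≠ d + 1 := (lt_of_le_of_lt hd' hlt).ne
      simp [hz₁, enterCode, Asg.run, hne]
    -- the state after `m` repetitions
    have key : ∀ m ≤ B + 1, ∀ w, w = runAll (List.replicate m
        (repeatCode M (d + 1) i ++ clause.code M (B + 1) (d + 1))).flatten z₁ →
        vars w = loopState f i a σ (min m R) ∧ w (.count (d + 1)) = (R - m : ℕ) ∧
        w (.next (d + 1)) = a + m ∧ AgreeUpTo d z₁ w := by
      intro m
      induction m with
      | zero =>
        rintro - w rfl
        simp [hv₁, hn₁, hc₁, loopState, AgreeUpTo]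
      | succ m ih =>
        rintro hm w rfl
        obtain ⟨i1, i2, i3, i4⟩ := ih (by omega) _ rfl
        rw [runAll_replicate_succ, runAll_append]
        set w := runAll (List.replicate m
          (repeatCode M (d + 1) i ++ clause.code M (B + 1) (d + 1))).flatten z₁ with hw
        have hwok := hok (min m R) (min_le_right _ _)
        -- Here `m ≤ B` and `a ≤ B`, so the next counter value is at most `2 B ≤ M`, even in a
        -- surplus copy.
        obtain ⟨j1, j2, j3, j4, j5⟩ := runAll_repeatCode (B := B) (M := M) (by omega) (d + 1) i w
          (by rw [i1]; exact hwok.inRange) (R - m) i2 (by omega) (by omega)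
        set w' := runAll (repeatCode M (d + 1) i) w with hw'
        have hw'v : vars w' = if m < R then Function.update (loopState f i a σ m) i (a + m) else
            loopState f i a σ R := by
          rw [j1, i1, i3]
          by_cases h : m < R
          · rw [if_pos (by omega), if_pos h, min_eq_left h.le]
          · rw [if_neg (by omega), if_neg h, min_eq_right (by omega)]
        have hgate : w' (.gate (d + 1)) = if m < R then 1 else 0 := by
          rw [j2]; congr 1; simp
        -- The induction hypothesis covers both values of the flag: the clause is executed if `m <
        -- R` and has no effect on the variables otherwise. In either case it preserves the control
        -- coordinates of this loop.
        obtain ⟨k1, k2⟩ := ihc (d + 1) w'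
          (by rw [hw'v]; split_ifs with h; exacts [(hst m h).1, hok R le_rfl]) hcc hwc
          (by omega) (by rw [hgate]; split_ifs <;> simp) (by
            rw [hgate, hw'v]
            intro h
            have h : m < R := by by_contra h'; simp [h'] at h
            rw [if_pos h]; exact (hst m h).2)
        refine ⟨?_, ?_, ?_, ?_⟩
        · rw [k1, hgate, hw'v]
          by_cases h : m < R
          · simp [h, loopState, hf]
          · simp [h, min_eq_right (show R ≤ m + 1 by omega)]
        · rw [← (k2 (d + 1) le_rfl).2.1, j3]; congr 1
        · rw [← (k2 (d + 1) le_rfl).2.2, j4, i3]; push_cast; ring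
        · refine i4.trans (AgreeUpTo.trans ?_ (k2.mono hlt.le))
          intro d' hd'
          obtain ⟨l1, l2, l3⟩ := j5 d' (lt_of_le_of_lt hd' hlt).ne
          exact ⟨l1.symm, l2.symm, l3.symm⟩
    obtain ⟨m1, -, -, m4⟩ := key (B + 1) le_rfl _ rfl
    rw [min_eq_right hRB] at m1
    set w := runAll (List.replicate (B + 1)
      (repeatCode M (d + 1) i ++ clause.code M (B + 1) (d + 1))).flatten z₁ with hw
    have haw := ha₁.trans m4
    have hgw := (haw d le_rfl).1
    obtain ⟨n1, n2⟩ := ihr d w (by rw [m1]; exact hok R le_rfl) hcr hwr (by omega)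
      (by rw [← hgw]; exact hg) (by
        rw [← hgw, m1]
        intro h
        rw [if_pos h] at hR
        rw [hR]; exact (hs h).2)
    refine ⟨?_, haw.trans n2⟩
    rw [n1, ← hgw, m1, hR]
    split_ifs <;> rfl

/-! ## Assignments as layers -/

namespace Lin
variable {ι : Type}

/-- Constant term of an affine expression. -/
def bias : Lin ι → ℤ
  | const c => c
  | coord _ => 0
  | add f g => f.bias + g.bias
  | smul c f => c * f.bias

lemma natAbs_bias_le (f : Lin ι) : f.bias.natAbs ≤ f.weight := by
  induction f with
  | const c => simp [bias]
  | coord i => simp [bias]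
  | add f g hf hg => exact (Int.natAbs_add_le _ _).trans (add_le_add hf hg)
  | smul c f hf => simp only [bias, weight, Int.natAbs_mul]; gcongr

end Lin

section Layer
variable {ι : Type} [DecidableEq ι] {w : ℕ}

namespace Lin

/-- Coefficients of an affine expression. -/
def coef : Lin ι → ι → ℤ
  | const _, _ => 0
  | coord i, j => if i = j then 1 else 0
  | add f g, j => f.coef j + g.coef j
  | smul c f, j => c * f.coef j

lemma eval_eq_sum [Fintype ι] (f : Lin ι) (z : ι → ℤ) :
    f.eval z = ∑ j, f.coef j * z j + f.bias := by
  induction f with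
  | const c => simp [eval, coef, bias]
  | coord i => simp [eval, coef, bias]
  | add f g hf hg => simp only [eval, coef, bias, hf, hg, add_mul, Finset.sum_add_distrib]; ring
  | smul c f hf => simp only [eval, coef, bias, hf, mul_assoc, mul_add, Finset.mul_sum]

lemma natAbs_coef_le (f : Lin ι) (j : ι) : (f.coef j).natAbs ≤ f.weight := by
  induction f with
  | const c => simp [coef]
  | coord i => simp only [coef, weight]; split_ifs <;> simp
  | add f g hf hg => exact (Int.natAbs_add_le _ _).trans (add_le_add hf hg)
  | smul c f hf => simp only [coef, weight, Int.natAbs_mul]; gcongr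

end Lin

/-- Weight matrix of the layer that carries out an assignment. -/
def Asg.matrix (e : ι ≃ Fin w) (a : Asg ι) : Matrix (Fin w) (Fin w) ℤ := fun i j =>
  if e.symm i = a.target then a.expr.coef (e.symm j) else if i = j then 1 else 0

/-- Bias vector of the layer that carries out an assignment. -/
def Asg.biasVec (e : ι ≃ Fin w) (a : Asg ι) : Fin w → ℤ := fun i =>
  if e.symm i = a.target then a.expr.bias else 0

/-- The layers of a sequence of assignments, followed by further layers. -/
def asgLayers (e : ι ≃ Fin w) (tail : Layers w 1) : List (Asg ι) → Layers w 1
  | [] => tail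
  | a :: l => .cons (a.matrix e) (a.biasVec e) (asgLayers e tail l)

lemma affine_intCast {n m : ℕ} (W : Matrix (Fin m) (Fin n) ℤ) (b : Fin m → ℤ) (z : Fin n → ℤ)
    (i : Fin m) : affine W b (fun j => (z j : ℝ)) i = ((∑ j, W i j * z j + b i : ℤ) : ℝ) := by
  simp [affine]

/-- All rows but one are identity rows; rectification leaves those coordinates unchanged because
they are nonnegative. -/
lemma Asg.sum_matrix_mul [Fintype ι] (e : ι ≃ Fin w) (a : Asg ι) (z : ι → ℤ) (hz : ∀ i, 0 ≤ z i)
    (i : Fin w) : max (∑ j, a.matrix e i j * z (e.symm j) + a.biasVec e i) 0 =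
      a.run z (e.symm i) := by
  by_cases h : e.symm i = a.target
  · simp only [Asg.matrix, Asg.biasVec, h, if_true, Asg.run, Function.update_self]
    rw [Lin.eval_eq_sum, Equiv.sum_comp e.symm fun j => a.expr.coef j * z j]
  · simp [Asg.matrix, Asg.biasVec, h, Asg.run, hz]

lemma Asg.run_nonneg (a : Asg ι) {z : ι → ℤ} (hz : ∀ i, 0 ≤ z i) (i : ι) : 0 ≤ a.run z i := by
  by_cases h : i = a.target
  · subst h; simp [Asg.run]
  · simp [Asg.run, h, hz]

lemma eval_asgLayers [Fintype ι] (e : ι ≃ Fin w) (tail : Layers w 1) (l : List (Asg ι)) (z : ι → ℤ)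
    (hz : ∀ i, 0 ≤ z i) :
    (asgLayers e tail l).eval (fun j => (z (e.symm j) : ℝ)) =
      tail.eval fun j => (runAll l z (e.symm j) : ℝ) := by
  induction l generalizing z with
  | nil => rfl
  | cons a l ih =>
    rw [asgLayers, Layers.eval, runAll_cons, ← ih _ (a.run_nonneg hz)]
    congr 1
    ext i
    rw [affine_intCast, ← a.sum_matrix_mul e z hz i]
    push_cast
    rfl

/-! ## Description length of a sequence of assignments -/

/-- The tokens of the layers of a sequence of assignments. -/
def asgTokens (e : ι ≃ Fin w) (l : List (Asg ι)) : List (List Symbol) :=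
  l.flatMap fun a => layerTokens (a.matrix e) (a.biasVec e)

lemma tokens_asgLayers (e : ι ≃ Fin w) (tail : Layers w 1) (l : List (Asg ι)) :
    (asgLayers e tail l).tokens = asgTokens e l ++ tail.tokens := by
  induction l with
  | nil => rfl
  | cons a l ih => rw [asgLayers, Layers.tokens_cons, ih]; simp [asgTokens]

/-- The tokens, with leading commas, have a description with at most `c` symbols. -/
def HasDescription (ts : List (List Symbol)) (c : ℕ) : Prop :=
  ∃ s, Expands s (commaJoin ts) ∧ s.length ≤ c ∧ ∀ a ∈ s.head?, ¬ a.IsDigit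

lemma HasDescription.mono {ts : List (List Symbol)} {c c' : ℕ} (h : HasDescription ts c)
    (hc : c ≤ c') : HasDescription ts c' := by
  obtain ⟨s, h1, h2, h3⟩ := h
  exact ⟨s, h1, h2.trans hc, h3⟩

lemma HasDescription.nil : HasDescription [] 0 := ⟨[], .nil, by simp, by simp⟩

lemma HasDescription.append {ts ts' : List (List Symbol)} {c c' : ℕ} (h : HasDescription ts c)
    (h' : HasDescription ts' c') : HasDescription (ts ++ ts') (c + c') := by
  obtain ⟨s, h1, h2, h3⟩ := h
  obtain ⟨s', h1', h2', h3'⟩ := h'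
  refine ⟨s ++ s', by simpa using h1.append h1' h3', by simp; omega, ?_⟩
  cases s with
  | nil => simpa using h3'
  | cons a s => simpa using h3

/-- This is why unrolling is cheap: two parentheses, a star and `log₂ K + 1` digits pay for all
copies. -/
lemma HasDescription.replicate {ts : List (List Symbol)} {c K : ℕ} (hK : 1 ≤ K)
    (h : HasDescription ts c) :
    HasDescription (List.replicate K ts).flatten (c + (Nat.log 2 K + 4)) := by
  obtain ⟨s, h1, h2, h3⟩ := h
  have e : commaJoin (List.replicate K ts).flatten =
      (List.replicate K (commaJoin ts)).flatten ++ [] := by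
    clear hK
    induction K with
    | zero => rfl
    | succ K ih => simp_all [List.replicate_succ]
  refine ⟨.lpar :: (s ++ .rpar :: .star :: (natBin K ++ [])), ?_, ?_, ?_⟩
  · rw [e]; exact .rep K s _ [] [] hK h1 .nil (by simp)
  · simp [length_natBin]; omega
  · simp [Symbol.IsDigit]

lemma isPlain_of_mem_commaJoin {ts : List (List Symbol)} (hp : ∀ t ∈ ts, ∀ a ∈ t, a.IsTokenSymbol) :
    ∀ a ∈ commaJoin ts, a.IsPlain := by
  intro a ha
  simp only [commaJoin, List.mem_flatten, List.mem_map] at ha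
  obtain ⟨_, ⟨u, hu, rfl⟩, ha⟩ := ha
  rcases List.mem_cons.1 ha with rfl | ha
  · trivial
  · exact (hp u hu a ha).1

lemma length_commaJoin_le {ts : List (List Symbol)} {k c : ℕ} (hk : ts.length ≤ k)
    (hc : ∀ t ∈ ts, t.length ≤ c) : (commaJoin ts).length ≤ k * (c + 1) := by
  refine le_trans ?_ (Nat.mul_le_mul_right _ hk)
  clear hk
  induction ts with
  | nil => simp
  | cons t ts ih =>
    have h1 := hc t (by simp)
    have h2 := ih fun t ht => hc t (by simp [ht])
    simp only [commaJoin_cons, List.length_cons, List.length_append, add_mul]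
    simp only [mul_add] at h2 ⊢
    omega

lemma HasDescription.of_length_le {ts : List (List Symbol)} {k c : ℕ} (hk : ts.length ≤ k)
    (hc : ∀ t ∈ ts, t.length ≤ c) (hp : ∀ t ∈ ts, ∀ a ∈ t, a.IsTokenSymbol) :
    HasDescription ts (k * (c + 1)) := by
  refine ⟨commaJoin ts, Expands.refl_of_isPlain (isPlain_of_mem_commaJoin hp),
    length_commaJoin_le hk hc, ?_⟩
  cases ts <;> simp [Symbol.IsDigit]

lemma length_intBin_le_of_natAbs_le {z : ℤ} {A : ℕ} (h : z.natAbs ≤ A) :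
    (intBin z).length ≤ Nat.log 2 A + 2 :=
  (length_intBin_le z).trans (by gcongr)

/-- There are `m n + m` entries and two markers; each entry takes at most `log₂ A + 2` symbols, for
sign and digits, and one comma. -/
lemma hasDescription_layerTokens {n m : ℕ} {W : Matrix (Fin m) (Fin n) ℤ} {b : Fin m → ℤ} {A : ℕ}
    (hW : ∀ i j, (W i j).natAbs ≤ A) (hb : ∀ i, (b i).natAbs ≤ A) :
    HasDescription (layerTokens W b) ((m * n + m + 2) * (Nat.log 2 A + 3)) := by
  refine .of_length_le ?_ (fun t ht => ?_) fun t ht a ha => isTokenSymbol_layerTokens ht ha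
  · simp [layerTokens, length_matrixTokens]; omega
  · simp only [layerTokens, List.mem_cons, List.mem_append] at ht
    rcases ht with rfl | h | rfl | h
    · simp
    · obtain ⟨i, j, rfl⟩ := mem_matrixTokens h; exact length_intBin_le_of_natAbs_le (hW i j)
    · simp
    · obtain ⟨i, rfl⟩ := mem_vectorTokens h; exact length_intBin_le_of_natAbs_le (hb i)

/-- Bound for the description length of a layer of width `w` with entries up to `A`. -/
def layerCost (w A : ℕ) : ℕ := (w * w + w + 2) * (Nat.log 2 A + 3)

lemma hasDescription_asgTokens (e : ι ≃ Fin w) {A : ℕ} (hA : 1 ≤ A) (l : List (Asg ι))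
    (hl : ∀ a ∈ l, a.expr.weight ≤ A) :
    HasDescription (asgTokens e l) (l.length * layerCost w A) := by
  induction l with
  | nil => simpa [asgTokens] using HasDescription.nil
  | cons a l ih =>
    have ha := hl a (by simp)
    have h1 : HasDescription (layerTokens (a.matrix e) (a.biasVec e)) (layerCost w A) := by
      refine hasDescription_layerTokens (fun i j => ?_) fun i => ?_
      · unfold Asg.matrix
        split_ifs
        · exact (a.expr.natAbs_coef_le _).trans ha
        · simpa using hA
        · simp
      · unfold Asg.biasVec
        split_ifs
        · exact a.expr.natAbs_bias_le.trans ha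
        · simp
    refine (h1.append (ih fun a ha => hl a (by simp [ha]))).mono ?_
    simp only [List.length_cons]; ring_nf; rfl

lemma asgTokens_append (e : ι ≃ Fin w) (l l' : List (Asg ι)) :
    asgTokens e (l ++ l') = asgTokens e l ++ asgTokens e l' := by simp [asgTokens]

lemma asgTokens_replicate (e : ι ≃ Fin w) (l : List (Asg ι)) (K : ℕ) :
    asgTokens e (List.replicate K l).flatten = (List.replicate K (asgTokens e l)).flatten := by
  induction K with
  | zero => rfl
  | succ K ih => rw [List.replicate_succ, List.replicate_succ, List.flatten_cons, List.flatten_cons,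
      asgTokens_append, ih]

end Layer

/-! ## Description length of the compiled program -/

section Compiled
variable {V T w : ℕ}

lemma Operand.weight_lin_le {B : ℕ} (hB : 1 ≤ B) {a : Operand V} (ha : a.ConstLe B) :
    (a.lin : Lin (Coord V T)).weight ≤ B := by
  cases a with
  | const c => simpa [Operand.lin, Operand.ConstLe] using ha
  | var v => simpa [Operand.lin] using hB

lemma Cmp.weight_le_of_mem_code {A : ℕ} (hA : 3 ≤ A) (r : Cmp) {x y : Lin (Coord V T)}
    (h : x.weight + y.weight + 1 ≤ A) : ∀ a ∈ r.code x y, a.expr.weight ≤ A := by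
  cases r <;> simp [Cmp.code] <;> omega

lemma Cmp.length_code_le (r : Cmp) (x y : Lin (Coord V T)) : (r.code x y).length ≤ 3 := by
  cases r <;> simp [Cmp.code]

lemma weight_le_of_mem_selectCode {M A : ℕ} (h : 2 * M + 1 ≤ A) (hA : 3 ≤ A) (d : Fin T)
    (k : Fin V) : ∀ a ∈ selectCode M d k, a.expr.weight ≤ A := by
  simp [selectCode]; omega

lemma Cmd.weight_le_of_mem_code {B M : ℕ} (hB : 2 ≤ B) (hM : 2 * B ≤ M) (d : Fin T) {c : Cmd V}
    (hc : c.ConstLe B) : ∀ a ∈ c.code M d, a.expr.weight ≤ 3 * M := by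
  intro x hx
  rcases List.mem_append.1 hx with h | h
  · clear hx
    revert x
    cases c with
    | assign k a =>
      have := Operand.weight_lin_le (T := T) (by omega) hc
      simp [Cmd.valueCode]; omega
    | ite k c a b =>
      have := Operand.weight_lin_le (T := T) (by omega) hc.1
      have := Operand.weight_lin_le (T := T) (by omega) hc.2
      simp [Cmd.valueCode]; omega
    | addConst k i c => simp only [Cmd.ConstLe] at hc; simp [Cmd.valueCode]; omega
    | mulConst k c i => simp only [Cmd.ConstLe] at hc; simp [Cmd.valueCode]; omega
    | cmpConst k r i c =>
      simp only [Cmd.ConstLe] at hc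
      intro x hx
      exact r.weight_le_of_mem_code (by omega) (by simp; omega) x hx
    | add k i j => simp [Cmd.valueCode]; omega
    | sub k i j => simp [Cmd.valueCode]; omega
    | cmp k r i j =>
      intro x hx
      exact r.weight_le_of_mem_code (by omega) (by simp; omega) x hx
  · exact weight_le_of_mem_selectCode (by omega) (by omega) d _ x h

lemma Cmd.length_code_le (M : ℕ) (d : Fin T) (c : Cmd V) : (c.code M d).length ≤ 6 := by
  have : (c.valueCode M : List (Asg (Coord V T))).length ≤ 3 := by
    cases c <;> simp [Cmd.valueCode, Cmp.length_code_le]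
  simp [Cmd.code, selectCode]; omega

/-- A plain statement needs at most 6 layers. A loop needs 3 to enter and 8 per repetition, written
once, and the repetition notation costs at most one more `layerCost`; hence the factor 12. -/
lemma Block.hasDescription [NeZero T] (e : Coord V T ≃ Fin w) {B M K : ℕ} (hB : 2 ≤ B)
    (hM : 2 * B ≤ M) (hK : 1 ≤ K) (hKM : K ≤ 3 * M) (b : Block V) (hb : b.ConstLe B) (d : Fin T) :
    HasDescription (asgTokens e (b.code M K d)) (b.length * (12 * layerCost w (3 * M))) := by
  set Q := layerCost w (3 * M) with hQ
  induction b generalizing d with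
  | done => simpa [Block.code, Block.length, asgTokens] using HasDescription.nil
  | cmd c rest ih =>
    rw [Block.code, asgTokens_append]
    have h1 := hasDescription_asgTokens e (by omega) _ (Cmd.weight_le_of_mem_code hB hM d hb.1)
    refine (h1.append (ih hb.2 d)).mono ?_
    have := Nat.mul_le_mul_right Q (c.length_code_le M d)
    simp only [Block.length, ← hQ, add_mul]
    omega
  | loop i s f clause rest ihc ihr =>
    obtain ⟨hs, hf, hc, hr⟩ := hb
    rw [Block.code, asgTokens_append, asgTokens_append, asgTokens_replicate, asgTokens_append]
    have h1 : HasDescription (asgTokens e (enterCode M d (d + 1) s f)) (3 * Q) := by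
      refine hasDescription_asgTokens e (by omega) _ ?_
      have := Operand.weight_lin_le (T := T) (by omega) hs
      have := Operand.weight_lin_le (T := T) (by omega) hf
      simp [enterCode]; omega
    have h2 : HasDescription (asgTokens e (repeatCode M (d + 1) i)) (8 * Q) := by
      refine hasDescription_asgTokens e (by omega) _ fun x hx => ?_
      rcases List.mem_append.1 hx with h | h
      · clear hx; revert x; simp; omega
      · exact weight_le_of_mem_selectCode (by omega) (by omega) _ _ x h
    have h3 := (h2.append (ihc hc (d + 1))).replicate hK
    refine (h1.append (h3.append (ihr hr d))).mono ?_
    have hlog : Nat.log 2 K + 4 ≤ Q := by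
      have : Nat.log 2 K ≤ Nat.log 2 (3 * M) := Nat.log_mono_right hKM
      rw [hQ, layerCost]
      nlinarith [Nat.zero_le (w * w + w), Nat.zero_le (Nat.log 2 (3 * M))]
    simp only [Block.length, add_mul]
    omega

/-- The coordinates, by kind. -/
def Coord.equivSum (V T : ℕ) : Coord V T ≃ Fin V ⊕ Bool ⊕ Fin T × Fin 3 where
  toFun
    | .var v => .inl v
    | .tmpA => .inr (.inl true)
    | .tmpB => .inr (.inl false)
    | .gate d => .inr (.inr (d, 0))
    | .count d => .inr (.inr (d, 1))
    | .next d => .inr (.inr (d, 2))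
  invFun
    | .inl v => .var v
    | .inr (.inl true) => .tmpA
    | .inr (.inl false) => .tmpB
    | .inr (.inr (d, 0)) => .gate d
    | .inr (.inr (d, 1)) => .count d
    | .inr (.inr (d, 2)) => .next d
  left_inv x := by cases x <;> rfl
  right_inv x := by
    rcases x with v | b | ⟨d, c⟩
    · rfl
    · cases b <;> rfl
    · fin_cases c <;> rfl

instance : Fintype (Coord V T) := .ofEquiv _ (Coord.equivSum V T).symm

lemma Coord.card_eq : Fintype.card (Coord V T) = V + 2 + T * 3 := by
  rw [Fintype.card_congr (Coord.equivSum V T)]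
  simp; ring

end Compiled

/-! ## The network of a simple neural program -/

section Network
variable {V I : ℕ}

/-- The program length serves as the number of nesting depths. The `return` statement makes it
exceed the length of the body, which leaves room for depth `0`. -/
instance (P : SNP V I) : NeZero P.length := ⟨by simp [SNP.length]⟩

/-- Width of the network that carries out `P`. -/
def SNP.width (P : SNP V I) : ℕ := V + 2 + P.length * 3

/-- Enumeration of the coordinates. -/
noncomputable def SNP.equiv (P : SNP V I) : Coord V P.length ≃ Fin P.width :=
  Fintype.equivFinOfCardEq Coord.card_eq

/-- The weight matrix that writes the input into the coordinates of the variables. -/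
noncomputable def SNP.firstMatrix (P : SNP V I) : Matrix (Fin P.width) (Fin V) ℤ := fun i v =>
  if P.equiv.symm i = .var v then 1 else 0

/-- The bias that sets the flag of the outermost block. -/
noncomputable def SNP.firstBias (P : SNP V I) : Fin P.width → ℤ := fun i =>
  if P.equiv.symm i = .gate 0 then 1 else 0

/-- The weight matrix that reads the returned variable. -/
noncomputable def SNP.lastMatrix (P : SNP V I) : Matrix (Fin 1) (Fin P.width) ℤ := fun _ j =>
  if P.equiv (.var P.ret) = j then 1 else 0

/-- The compiled program, for values up to `B`. -/
noncomputable def SNP.code (P : SNP V I) (B : ℕ) : List (Asg (Coord V P.length)) :=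
  P.body.code (B * B) (B + 1) 0

/-- The network that carries out `P` on inputs where `P` is `B`-bounded. -/
noncomputable def SNP.network (P : SNP V I) (B : ℕ) : Network I where
  dim := V
  input v := (P.decl v).slot
  free_eq := P.inputs_eq
  layers := .cons P.firstMatrix P.firstBias
    (asgLayers P.equiv (.last P.lastMatrix fun _ => 0) (P.code B))

lemma intCast_fill {m : ℕ} (s : Fin m → Option ℤ) {N : ℕ} (x : Box I N) (p : Fin m) :
    fill s (x.vec ℝ) p = ((fill s (x.vec ℤ) p : ℤ) : ℝ) := by
  unfold fill Box.vec
  split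
  · simp
  · split_ifs <;> simp

lemma SNP.eval_network (P : SNP V I) {N B : ℕ} (hB : 2 ≤ B) (hP : P.BoundedOn N B) (x : Box I N) :
    (P.network B).eval (x.vec ℝ) = (P.eval (x.vec ℤ) : ℝ) := by
  obtain ⟨hc, hx⟩ := hP
  obtain ⟨hok, hall⟩ := hx x
  set σ := P.init (x.vec ℤ) with hσ
  -- The state after the first layer: the variables are initialised and only the outermost block is
  -- active.
  let z : Coord V P.length → ℤ
    | .var v => σ v
    | .gate d => if d = 0 then 1 else 0
    | _ => 0
  have hz : ∀ i, 0 ≤ z i := by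
    intro i
    cases i <;> simp only [z, le_refl]
    · exact (hok _).1
    · split_ifs <;> simp
  have hvz : vars z = σ := rfl
  have hgz : z (.gate 0) = 1 := by simp [z]
  have hrun := (Block.runAll_code (M := B * B) hB le_rfl P.body (0 : Fin P.length) z
    (isBool := fun v => (P.decl v).IsBool) hok hc P.wellFormed
    (by simp [SNP.length]) (.inr hgz) fun _ => hall).1
  rw [if_pos hgz, hvz] at hrun
  have hret : runAll (P.code B) z (.var P.ret) = P.eval (x.vec ℤ) := congrFun hrun P.ret
  have hfirst : (fun i => max (affine P.firstMatrix P.firstBias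
      (fill (fun v => (P.decl v).slot) (x.vec ℝ)) i) 0) = fun i => (z (P.equiv.symm i) : ℝ) := by
    ext i
    have : fill (fun v => (P.decl v).slot) (x.vec ℝ) = fun v => (σ v : ℝ) := by
      ext v; exact intCast_fill _ _ _
    rw [this, affine_intCast]
    norm_cast
    have h0 := hz (P.equiv.symm i)
    simp only [SNP.firstMatrix, SNP.firstBias]
    cases h : P.equiv.symm i <;> rw [h] at h0 <;> simp [z]
    · exact (hok _).1
    · split_ifs <;> simp
  change (Layers.eval _ _) 0 = _
  simp only [SNP.network, Layers.eval]
  rw [hfirst, eval_asgLayers _ _ _ _ hz, Layers.eval, affine_intCast, ← hret]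
  simp [SNP.lastMatrix]

lemma SNP.descLength_network_le (P : SNP V I) {N B : ℕ} (hB : 2 ≤ B) (hP : P.BoundedOn N B)
    (x : Box I N) :
    (P.network B).descLength ≤ P.length * (12 * layerCost P.width (3 * (B * B))) := by
  have hM : 2 * B ≤ B * B := Nat.mul_le_mul_right _ hB
  have hV : 0 < V := P.ret.pos
  set Q := layerCost P.width (3 * (B * B)) with hQ
  have hbody : HasDescription (asgTokens P.equiv (P.code B)) (P.body.length * (12 * Q)) :=
    Block.hasDescription P.equiv hB hM (by omega) (by omega) P.body hP.1 0
  have hw : V ≤ P.width := by simp only [SNP.width]; omega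
  have hfirst : HasDescription (layerTokens P.firstMatrix P.firstBias) Q := by
    refine (hasDescription_layerTokens (A := 3 * (B * B)) (fun i j => ?_) fun i => ?_).mono ?_
    · unfold SNP.firstMatrix; split_ifs <;> simp; omega
    · unfold SNP.firstBias; split_ifs <;> simp; omega
    · rw [hQ, layerCost]; gcongr
  have hlast : HasDescription (layerTokens P.lastMatrix fun _ => 0) Q := by
    refine (hasDescription_layerTokens (A := 3 * (B * B)) (fun i j => ?_) fun i => ?_).mono ?_
    · unfold SNP.lastMatrix; split_ifs <;> simp; omega
    · simp
    · rw [hQ, layerCost]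
      gcongr ?_ * _
      nlinarith
  obtain ⟨s, h1, h2, h3⟩ := hfirst.append (hbody.append hlast)
  have htok : (P.network B).tokens = inputTokens (fun v => (P.decl v).slot) ++
      (layerTokens P.firstMatrix P.firstBias ++ (asgTokens P.equiv (P.code B) ++
        layerTokens P.lastMatrix fun _ => 0)) := by
    simp only [Network.tokens, SNP.network, Layers.tokens_cons, tokens_asgLayers,
      Layers.tokens_last]
  have hinput : (commaJoin (inputTokens fun v => (P.decl v).slot)).length ≤ Q := by
    refine (length_commaJoin_le (k := V) (c := Nat.log 2 (3 * (B * B)) + 2)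
      (by simp [inputTokens]) fun t ht => ?_).trans ?_
    · obtain ⟨v, rfl⟩ := mem_inputTokens ht
      cases h : (P.decl v).slot with
      | none => simp [slotToken]
      | some c =>
        -- Declared initial values are bounded only through the initial state of a run, which is why
        -- some input `x` is needed.
        apply length_intBin_le_of_natAbs_le
        have hv : P.init (x.vec ℤ) v = c := by simp [SNP.init, fill, h]
        have := (hP.2 x).1 v
        rw [hv] at this
        omega
    · rw [hQ, layerCost]
      gcongr ?_ * _
      nlinarith
  have hplain := isPlain_of_mem_commaJoin fun t ht a ha =>
    isTokenSymbol_inputTokens (s := fun v => (P.decl v).slot) (t := t) ht ha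
  -- The encoding has no comma before its first token, so that token is split off; it exists because
  -- the returned variable forces `V > 0`.
  obtain ⟨t, ts, e⟩ : ∃ t ts, inputTokens (fun v => (P.decl v).slot) = t :: ts := by
    apply List.exists_cons_of_ne_nil
    rw [ne_eq, ← List.length_eq_zero_iff]
    simp [inputTokens, hV.ne']
  rw [e] at hinput htok hplain
  simp only [commaJoin_cons, List.length_cons] at hinput hplain
  have hd : Describes ((t ++ commaJoin ts) ++ s) (P.network B) := by
    rw [Describes, Network.encode_eq, htok, List.cons_append, intercalate_comma_cons,
      commaJoin_append, ← List.append_assoc]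
    exact (Expands.refl_of_isPlain fun a ha => hplain a (by simp [ha])).append h1 h3
  refine (Network.descLength_le hd).trans ?_
  -- The input vector, the first layer and the last layer cost at most `3 Q`, which fits into the
  -- `12 Q` allotted to the `return` statement.
  rw [List.length_append, SNP.length, add_mul]
  omega

end Network

/-! ### Explicit constants in the length bound. -/

lemma log_three_mul_le {B : ℕ} (hB : 2 ≤ B) :
    Nat.log 2 (3 * (B * B)) + 3 ≤ 10 * Nat.log 2 B := by
  have h1 : B < 2 ^ (Nat.log 2 B + 1) := Nat.lt_pow_succ_log_self (by norm_num) B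
  have h0 : 0 < Nat.log 2 B := Nat.log_pos (by norm_num) hB
  have h2 : 3 * (B * B) < 2 ^ (2 + 2 * (Nat.log 2 B + 1)) := by
    rw [pow_add, pow_mul', pow_two (2 ^ (Nat.log 2 B + 1))]
    nlinarith [Nat.mul_lt_mul'' h1 h1]
  have h3 := Nat.log_lt_of_lt_pow (by positivity) h2
  omega

lemma SNP.cost_le {V I : ℕ} (P : SNP V I) {B : ℕ} (hB : 2 ≤ B) :
    ((P.length * (12 * layerCost P.width (3 * (B * B))) : ℕ) : ℝ) ≤
      26000 * (P.length : ℝ) ^ 3 * (V : ℝ) ^ 2 * Real.log B := by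
  have hV : 1 ≤ V := P.ret.pos
  have hL : 1 ≤ P.length := by simp [SNP.length]
  have hw : P.width ≤ 6 * (P.length * V) := by
    simp only [SNP.width]; nlinarith [Nat.mul_le_mul hL hV]
  have hw1 : 1 ≤ P.width := by simp only [SNP.width]; omega
  have hQ : layerCost P.width (3 * (B * B)) ≤ 4 * (6 * (P.length * V)) ^ 2 * (10 * Nat.log 2 B) := by
    rw [layerCost]
    exact Nat.mul_le_mul (by nlinarith) (log_three_mul_le hB)
  -- The factor `1.5` exceeds `1 / ln 2`.
  have hlog : (Nat.log 2 B : ℝ) ≤ 1.5 * Real.log B := by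
    have h1 : (2 : ℝ) ^ Nat.log 2 B ≤ B := by
      exact_mod_cast Nat.pow_log_le_self 2 (by omega)
    have h2 := Real.log_le_log (by positivity) h1
    rw [Real.log_pow] at h2
    have := Real.log_two_gt_d9
    have h3 : (0 : ℝ) ≤ Nat.log 2 B := by positivity
    nlinarith
  -- The constants multiply to `12 · 4 · 36 · 10 = 17280`, and `1.5 · 17280 = 25920`.
  calc ((P.length * (12 * layerCost P.width (3 * (B * B))) : ℕ) : ℝ)
      ≤ ((P.length * (12 * (4 * (6 * (P.length * V)) ^ 2 * (10 * Nat.log 2 B))) : ℕ) : ℝ) := by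
        gcongr
    _ = 17280 * (P.length : ℝ) ^ 3 * (V : ℝ) ^ 2 * Nat.log 2 B := by push_cast; ring
    _ ≤ 17280 * (P.length : ℝ) ^ 3 * (V : ℝ) ^ 2 * (1.5 * Real.log B) := by gcongr
    _ ≤ _ := by
      have : 0 ≤ (P.length : ℝ) ^ 3 * (V : ℝ) ^ 2 * Real.log B := by positivity
      nlinarith

end SNPNet

/-! ### The bound for the error probability. -/

open SNPNet
theorem corollary5p2 :
    ∃ C : ℝ, 0 < C ∧
      ∀ (V I N B n : ℕ) (P : SNP V I), 2 ≤ B → P.BoundedOn N B → 0 < n →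
        ∀ (μ : Measure (Box I N)) [IsProbabilityMeasure μ]
          (fMDL : (Fin n → Box I N × ℤ) → Network I),
          (∀ X : Fin n → Box I N, IsMDLInterpolator (P.dataset X) (fMDL (P.dataset X))) →
          ((Measure.pi fun _ : Fin n => μ).prod μ).real
              {p : (Fin n → Box I N) × Box I N |
                (fMDL (P.dataset p.1)).eval (p.2.vec ℝ) ≠ (P.eval (p.2.vec ℤ) : ℝ)} ≤
            C * (P.length : ℝ) ^ 3 * (V : ℝ) ^ 2 * Real.log (B : ℝ) / (n : ℝ) := by
  -- Any constant from `10 · 26000 + 2` on works: `ln 11 ≤ 10` multiplies the length bound, and the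
  -- additive `1` is at most `2 L³V² ln B`.
  refine ⟨300000, by norm_num, ?_⟩
  intro V I N B n P hB hP hn μ _ fMDL hf
  obtain ⟨x₀⟩ : Nonempty (Box I N) := nonempty_of_isProbabilityMeasure μ
  set S := P.length * (12 * layerCost P.width (3 * (B * B))) with hS
  -- The compiled network interpolates every data set generated by `P`, so minimality bounds the
  -- description length of the MDL choice.
  have hle : ∀ X : Fin n → Box I N, (fMDL (P.dataset X)).descLength ≤ S := fun X =>
    ((hf X).2 (P.network B) fun i => P.eval_network hB hP (X i)).trans
      (P.descLength_network_le hB hP x₀)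
  obtain ⟨c, hc⟩ := exists_injOn_descLength_le I S
  have : Nonempty (Network I) := ⟨P.network B⟩
  -- Each code word is decoded to a network, and `E` is its error set. Words that encode no short
  -- network decode to an arbitrary one, which is harmless since every word is counted anyway.
  let E : (Fin S → Option (Fin 10)) → Set (Box I N) := fun b =>
    {x | (Function.invFunOn c {F | F.descLength ≤ S} b).eval (x.vec ℝ) ≠ (P.eval (x.vec ℤ) : ℝ)}
  have hE : ∀ X : Fin n → Box I N, E (c (fMDL (P.dataset X))) =
      {x | (fMDL (P.dataset X)).eval (x.vec ℝ) ≠ (P.eval (x.vec ℤ) : ℝ)} := by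
    intro X
    simp only [E]
    rw [hc.leftInvOn_invFunOn (hle X)]
  have key := measureReal_mem_le_of_consistent μ hn E (fun X => c (fMDL (P.dataset X)))
    (fun X i => by
      rw [hE X]
      exact not_not.2 ((hf X).1 i))
  simp only [hE] at key
  refine key.trans ?_
  gcongr
  have hcard : Real.log (Fintype.card (Fin S → Option (Fin 10))) = S * Real.log 11 := by
    simp
  have h11 : Real.log 11 ≤ 10 := by
    have := Real.log_le_sub_one_of_pos (show (0 : ℝ) < 11 by norm_num); linarith
  have hcost := P.cost_le hB
  rw [← hS] at hcost
  have hV : (1 : ℝ) ≤ V := by exact_mod_cast P.ret.pos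
  have hL : (1 : ℝ) ≤ P.length := by simp [SNP.length]
  have hlogB : 1 ≤ 2 * Real.log B := by
    have h2 : Real.log 2 ≤ Real.log B := Real.log_le_log (by norm_num) (by exact_mod_cast hB)
    have := Real.log_two_gt_d9
    linarith
  have hone : 1 ≤ 2 * ((P.length : ℝ) ^ 3 * (V : ℝ) ^ 2 * Real.log B) := by
    have h1 : (1 : ℝ) ≤ (P.length : ℝ) ^ 3 * (V : ℝ) ^ 2 :=
      one_le_mul_of_one_le_of_one_le (one_le_pow₀ hL) (one_le_pow₀ hV)
    nlinarith
  have hSn : (0 : ℝ) ≤ S := by positivity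
  rw [hcard]
  nlinarith
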